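/- **Setting.** Let $d\ge 1$. In each round $t=1,2,\dots$ of a two-armed contextual bandit a context $X_t\in[0,1]^d$ is drawn i.i.d. from $\mathbf P_X$, a policy chooses an arm $\pi_t\in\{1,2\}$ as a measurable function of $X_1,\dots,X_t$, of the rewards observed so far and of an independent randomization device, and observes a reward in $\{0,1\}$ with conditional mean $f_{\pi_t}(X_t)$. The regret of $\pi$ on an instance $\mathsf P$ is $$\mathcal R^\pi(\mathsf P;T)=\mathbb E\Big[\sum_{t=1}^T\big(\max_k f_k(X_t)-f_{\pi_t}(X_t)\big)\Big].$$ For constants $L,C_0>0$ and $0<\underline\rho\le 1\le\bar\rho$, let $\mathcal P(\beta,\alpha,d)=\mathcal P(\beta,L,\alpha,C_0,\underline\rho,\bar\rho)$ be the class of instances such that: - (Hölder smoothness) each $f_k$ is $\lfloor\beta\rfloor$ times continuously differentiable on $[0,1]^d$, where $\lfloor\beta\rfloor$ is the largest integer strictly below $\beta$, and $|f_k(x')-f_{k,x}(x')|\le L\|x-x'\|_\infty^\beta$ for all $x,x'\in[0,1]^d$, where $f_{k,x}$ is the Taylor polynomial of degree $\lfloor\beta\rfloor$ of $f_k$ at $x$;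 - (contexts) $\mathbf P_X$ has a Lebesgue density on $[0,1]^d$ with values in $[\underline\rho,\bar\rho]$; - (margin) $\mathbf P_X\{0<|f_1(X)-f_2(X)|\le\delta\}\le C_0\delta^\alpha$ for all $0<\delta\le1$. Put $\zeta(\beta,\alpha,d)=1-\frac{\beta(1+\alpha)}{2\beta+d}$. **Theorem.** Fix $0<\beta<\gamma$, $0<\alpha\le\max\{1,\frac1\gamma\}$, $L>0$ and $0<\underline\rho\le1\le\bar\rho$. For every sufficiently large $C_0$ (depending on these parameters and on $d$) there is $T_0$ such that for every $C_r>0$ there is $\underline C>0$ with the following property. For every $T\ge T_0$ and every admissible policy $\pi$ with $\sup_{\mathsf P\in\mathcal P(\gamma,\alpha,d)}\mathcal R^\pi(\mathsf P;T)\le C_r\,T^{\zeta(\gamma,\alpha,d)}$: 1. if $0<\beta<\gamma\le1$, then $$\sup_{\mathsf P\in\mathcal P(\beta,\alpha,d)}\mathcal R^\pi(\mathsf P;T)\ \ge\ \underline C\,T^{1-\frac{\beta+d}{(\alpha+1)(2\beta+d-\alpha\beta)}}\big[T^{\zeta(\gamma,\alpha,d)}\big]^{-\frac{\alpha(\beta+d)}{(\alpha+1)(2\beta+d-\alpha\beta)}};$$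 2. if $\beta=1<\gamma$, then $$\sup_{\mathsf P\in\mathcal P(1,\alpha,d)}\mathcal R^\pi(\mathsf P;T)\ \ge\ \underline C\,T^{\frac{\alpha}{\alpha+1}}\big[T^{\zeta(\gamma,\alpha,d)}\big]^{-\frac{\alpha}{\alpha+1}}.$$ Moreover, for every sufficiently large $C_0$ as above: if, in case 1 or in case 2, the total exponent of $T$ in the lower bound exceeds the exponent $\zeta(\beta,\alpha,d)$ of the optimal rate over $\mathcal P(\beta,\alpha,d)$, then for all $0<\underline\beta\le\beta<\gamma\le\bar\beta$ no policy (even one that may depend on $T$) is smoothness-adaptive over $[\underline\beta,\bar\beta]$. Here smoothness-adaptive means that for all $\beta'\in[\underline\beta,\bar\beta]$ and $0<\alpha'\le\frac1{\min\{1,\beta'\}}$ there are $\iota,\bar C>0$ such that $\sup_{\mathsf P\in\mathcal P(\beta',\alpha',d)}\mathcal R^\pi(\mathsf P;T)\le\bar C(\log T)^{\iota}T^{\zeta(\beta',\alpha',d)}$ for all large $T$. Such parameters exist in both cases: for some $d\ge1$, $0<\beta<\gamma\le1$ and $0<\alpha\le\max\{1,\frac1\gamma\}$ the exponent in 1 exceeds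 $\zeta(\beta,\alpha,d)$; and for $d=1$, $\alpha=1$ and every $\gamma>1$ the exponent in 2 exceeds $\zeta(1,1,1)$. -/

import Mathlib

open MeasureTheory ProbabilityTheory Filter

universe u

noncomputable section

namespace SmoothBandit

/-- Points of `ℝ^d`, with the sup norm; contexts live in the unit cube. -/
abbrev Ctx (d : ℕ) : Type := Fin d → ℝ

/-- The unit cube `[0,1]^d`. -/
def cube (d : ℕ) : Set (Ctx d) := Set.Icc 0 1

/-- A two-armed contextual bandit instance with `{0,1}`-valued rewards (`true` is the reward `1`):
a context distribution on the cube, and for each arm `k : Fin 2` and context `x` the conditional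
law `reward (k, x)` of the reward of arm `k` given the context `x`. -/
structure Instance (d : ℕ) where
  PX : Measure (Ctx d)
  isProbabilityMeasure_PX : IsProbabilityMeasure PX
  PX_compl_cube : PX (cube d)ᶜ = 0
  reward : Kernel (Fin 2 × Ctx d) Bool
  isMarkovKernel_reward : IsMarkovKernel reward

attribute [instance] Instance.isProbabilityMeasure_PX Instance.isMarkovKernel_reward

/-- The payoff function `f_k(x) = E[Y_k | X = x] = P(Y_k = 1 | X = x)`. -/
def Instance.payoff {d : ℕ} (P : Instance d) (k : Fin 2) (x : Ctx d) : ℝ :=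
  (P.reward (k, x)).real {true}

/-- The contexts and observed rewards of the first `t` rounds. -/
abbrev History (d t : ℕ) : Type := Fin t → Ctx d × Bool

/-- An admissible policy: a randomization device `(U, PU)` and, for every `t`, a measurable choice
of the arm in the round that follows `t` completed rounds, as a function of the device, the
contexts and observed rewards of these `t` rounds, and the current context. -/
structure Policy (d : ℕ) where
  U : Type u
  measurableSpace_U : MeasurableSpace U
  PU : Measure U
  isProbabilityMeasure_PU : IsProbabilityMeasure PU
  act : (t : ℕ) → (U × History d t) × Ctx d → Fin 2
  measurable_act : ∀ t, Measurable (act t)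

attribute [instance] Policy.measurableSpace_U Policy.isProbabilityMeasure_PU

/-- The conditional law of the context and the observed reward of the next round, given the device
and the history of `t` rounds: the context is drawn from `PX` independently of the past, the policy
chooses an arm, and the reward is drawn from the law of that arm given the context. -/
def roundKernel {d : ℕ} (π : Policy.{u} d) (P : Instance d) (t : ℕ) :
    Kernel (π.U × History d t) (Ctx d × Bool) :=
  (Kernel.const (π.U × History d t) P.PX) ⊗ₖ
    (P.reward.comap (fun w => (π.act t w, w.2)) ((π.measurable_act t).prodMk measurable_snd))

/-- The joint law of the device and of the history of the first `t` rounds. -/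
def historyLaw {d : ℕ} (π : Policy.{u} d) (P : Instance d) : (t : ℕ) → Measure (π.U × History d t)
  | 0 => π.PU.map (fun v => (v, Fin.elim0))
  | t + 1 => ((historyLaw π P t) ⊗ₘ (roundKernel π P t)).map
      (fun w => (w.1.1, Fin.snoc (α := fun _ => Ctx d × Bool) w.1.2 w.2))

/-- The expected regret over `T` rounds: the sum over the rounds of the expected gap between the
payoff of the best arm and of the chosen arm at the current context. -/
def regret {d : ℕ} (π : Policy.{u} d) (P : Instance d) (T : ℕ) : ℝ :=
  ∑ t ∈ Finset.range T,
    ∫ w, (max (P.payoff 0 w.2) (P.payoff 1 w.2) - P.payoff (π.act t w) w.2)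
      ∂((historyLaw π P t).prod P.PX)

/-- The largest integer strictly less than `β`, for `β > 0`. -/
def strictFloor (β : ℝ) : ℕ := ⌈β⌉₊ - 1

/-- The value at `y` of the Taylor polynomial of degree `n` of `f` at `x`, with the derivatives
of `f` on the unit cube. -/
def taylorOnCube {d : ℕ} (n : ℕ) (f : Ctx d → ℝ) (x y : Ctx d) : ℝ :=
  ∑ j ∈ Finset.range (n + 1),
    (1 / (j.factorial : ℝ)) * iteratedFDerivWithin ℝ j f (cube d) x (fun _ => y - x)

/-- The Hölder class with exponent `β` and constant `L` on the unit cube. -/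
def IsHolder {d : ℕ} (β L : ℝ) (f : Ctx d → ℝ) : Prop :=
  ContDiffOn ℝ (strictFloor β) f (cube d) ∧
    ∀ x ∈ cube d, ∀ y ∈ cube d, |f y - taylorOnCube (strictFloor β) f x y| ≤ L * ‖x - y‖ ^ β

/-- `PX` has a density with respect to Lebesgue measure on the cube with values in
`[ρmin, ρmax]`. -/
def HasBoundedDensity {d : ℕ} (ρmin ρmax : ℝ) (PX : Measure (Ctx d)) : Prop :=
  ∃ p : Ctx d → ℝ, Measurable p ∧ (∀ x ∈ cube d, ρmin ≤ p x ∧ p x ≤ ρmax) ∧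
    PX = (volume.restrict (cube d)).withDensity (fun x => ENNReal.ofReal (p x))

/-- The margin condition with exponent `α` and constant `C₀`. -/
def MarginCondition {d : ℕ} (α C₀ : ℝ) (P : Instance d) : Prop :=
  ∀ δ : ℝ, 0 < δ → δ ≤ 1 →
    P.PX.real {x | 0 < |P.payoff 0 x - P.payoff 1 x| ∧ |P.payoff 0 x - P.payoff 1 x| ≤ δ} ≤
      C₀ * δ ^ α

/-- The class of problems `𝒫(β, α, d) = 𝒫(β, L, α, C₀, ρmin, ρmax)`. -/
def problemClass (d : ℕ) (β L α C₀ ρmin ρmax : ℝ) : Set (Instance d) :=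
  {P | (∀ k, IsHolder β L (P.payoff k)) ∧ HasBoundedDensity ρmin ρmax P.PX ∧
    MarginCondition α C₀ P}

/-- The worst-case regret of a policy over a class of problems. -/
def worstRegret {d : ℕ} (π : Policy.{u} d) (S : Set (Instance d)) (T : ℕ) : EReal :=
  ⨆ P ∈ S, (regret π P T : EReal)

/-- The exponent `ζ(β, α, d)` of the optimal regret rate `T ^ ζ(β, α, d)`. -/
def zeta (β α : ℝ) (d : ℕ) : ℝ := 1 - β * (1 + α) / (2 * β + d)

/-- A policy (more generally, a family of policies indexed by the horizon length) is
smoothness-adaptive over `[βmin, βmax]` if for all `β` in this range and all relevant margin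
parameters its worst-case regret is optimal up to a polylogarithmic factor, for large horizons. -/
def SmoothnessAdaptive {d : ℕ} (π : ℕ → Policy.{u} d) (βmin βmax L C₀ ρmin ρmax : ℝ) : Prop :=
  ∀ β α : ℝ, βmin ≤ β → β ≤ βmax → 0 < α → α ≤ 1 / min 1 β →
    ∃ ι > (0 : ℝ), ∃ C > (0 : ℝ), ∀ᶠ T : ℕ in atTop,
      worstRegret (π T) (problemClass d β L α C₀ ρmin ρmax) T ≤
        ((C * Real.log T ^ ι * (T : ℝ) ^ zeta β α d : ℝ) : EReal)

/-- The exponent of `T` in the lower bound for `0 < β < γ ≤ 1`. -/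
def lowerExponent (β γ α : ℝ) (d : ℕ) : ℝ :=
  1 - (β + d) / ((α + 1) * (2 * β + d - α * β))
    - zeta γ α d * (α * (β + d) / ((α + 1) * (2 * β + d - α * β)))

/-- The exponent of `T` in the lower bound for `1 = β < γ`. -/
def lowerExponentOne (γ α : ℝ) (d : ℕ) : ℝ :=
  α / (α + 1) - zeta γ α d * (α / (α + 1))

end SmoothBandit

end

/-!
All instances have uniform contexts, `f₁ = 1/2` and `f₂ = 1/2 - g`, and are described by the gap
`g`. The idea: a policy whose regret is at most `R` on a `γ`-smooth instance `P` with positive gap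
can afford few pulls of the second arm where the gap is about `Δ`. If this region contains `M`
disjoint cells, some cell receives at most `R / (Δ M)` pulls (`exists_rarely_explored_cell`).
Changing the sign of the gap in that cell only gives a `β`-Hölder instance `Q`. The
Kullback-Leibler divergence of the two histories is at most a constant times `Δ²` times the number
of pulls, so for `Δ R / M` small the policy cannot tell `Q` from `P` and keeps choosing the wrong
arm in the cell, at a regret of order `T Δ m`, where `m` is the mass of the cell
(`two_instance_lower_bound`, `worstRegret_lower_bound`). As `P` is in the rough class as well, a
policy that does pull the second arm in most visits to the cell pays for it under `P`, so that `T`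
need not be large.

Two families of instances are used.

* If `α γ ≤ d`, the gap equals `Δ ≍ h ^ β` on a cube of volume `h ^ (α β)`, the largest that the
  margin condition allows, and grows like the power `γ` of the distance outside. The cells have
  side `h`, so `M ≍ h ^ (α β - d)` and `m ≍ h ^ d`. With `h` proportional to
  `R ^ (-1 / (β + d - α β))` the regret is at least of order `T R ^ (-(β + d) / (β + d - α β))`
  (`flat_lower_bound`). In its cell the perturbed gap crosses zero like a signed power `β`, which
  preserves the margin condition because `α β ≤ 1`.
* If `α γ > d`, then `γ > 1`, `β = 1`, `α ≤ 1`, and a gap that grows like the power `γ` of a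
  distance violates the margin condition. The gap is linear in one coordinate instead, the only
  cell is a boundary layer of width `w ≍ Δ`, and the regret is at least of order `T R ^ (-2)`
  (`ridge_lower_bound`).

For `R` of order `T ^ ζ(γ, α, d)` these bounds are at least as large as the claimed ones; in the
first family this rests on `ζ(γ, α, d) ≤ ζ(β, α, d)` (`exists_lower_bound`). As `R` is arbitrary, a
polylogarithmic factor in the regret over the smooth class costs an arbitrarily small power of `T`,
whence `not_smoothnessAdaptive`.
-/

noncomputable section

namespace SmoothBandit

variable {d : ℕ}

/-! ### One-step disintegration of the history law -/

/-- The probability that a Bernoulli variable with mean `p` takes the value `y`. -/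
def bern (p : ℝ) (y : Bool) : ℝ := if y then p else 1 - p

lemma measurable_payoff_uncurry (P : Instance d) :
    Measurable (fun kx : Fin 2 × Ctx d => P.payoff kx.1 kx.2) :=
  (Kernel.measurable_coe P.reward (MeasurableSet.singleton true)).ennreal_toReal

lemma measurable_payoff (P : Instance d) (k : Fin 2) : Measurable (P.payoff k) :=
  (measurable_payoff_uncurry P).comp (measurable_const.prodMk measurable_id)

lemma reward_real_singleton (P : Instance d) (k : Fin 2) (x : Ctx d) (y : Bool) :
    (P.reward (k, x)).real {y} = bern (P.payoff k x) y := by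
  cases y
  · have h := measureReal_compl (μ := P.reward (k, x)) (MeasurableSet.singleton true)
    have e : ({true}ᶜ : Set Bool) = {false} := by ext b; cases b <;> simp
    rw [e, probReal_univ] at h
    simp [bern, h, Instance.payoff]
  · simp [bern, Instance.payoff]

lemma payoff_nonneg (P : Instance d) (k : Fin 2) (x : Ctx d) : 0 ≤ P.payoff k x :=
  measureReal_nonneg

lemma payoff_le_one (P : Instance d) (k : Fin 2) (x : Ctx d) : P.payoff k x ≤ 1 :=
  measureReal_le_one

instance (π : Policy.{u} d) (P : Instance d) (t : ℕ) : IsMarkovKernel (roundKernel π P t) := by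
  unfold roundKernel; infer_instance

lemma measurable_snoc_history (t : ℕ) :
    Measurable (fun w : History d t × (Ctx d × Bool) =>
      (Fin.snoc (α := fun _ => Ctx d × Bool) w.1 w.2 : History d (t + 1))) := by
  refine measurable_pi_iff.2 fun i => ?_
  refine Fin.lastCases ?_ (fun i => ?_) i
  · simpa using measurable_snd
  · simp only [Fin.snoc_castSucc]
    exact (measurable_pi_apply i).comp measurable_fst

lemma measurable_extend_history {U : Type u} [MeasurableSpace U] (t : ℕ) :
    Measurable (fun w : (U × History d t) × (Ctx d × Bool) =>
      ((w.1.1, Fin.snoc (α := fun _ => Ctx d × Bool) w.1.2 w.2) : U × History d (t + 1))) :=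
  (measurable_fst.comp measurable_fst).prodMk ((measurable_snoc_history t).comp
    ((measurable_snd.comp measurable_fst).prodMk measurable_snd))

instance (π : Policy.{u} d) (P : Instance d) (t : ℕ) :
    IsProbabilityMeasure (historyLaw π P t) := by
  induction t with
  | zero => exact Measure.isProbabilityMeasure_map (by fun_prop)
  | succ t ih =>
    exact Measure.isProbabilityMeasure_map (measurable_extend_history t).aemeasurable

lemma integrable_of_bounded {α : Type*} [MeasurableSpace α] {μ : Measure α} [IsFiniteMeasure μ]
    {f : α → ℝ} (hf : Measurable f) {C : ℝ} (hC : ∀ x, |f x| ≤ C) : Integrable f μ :=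
  Integrable.of_bound hf.aestronglyMeasurable C (Eventually.of_forall hC)

/-- One-step disintegration of the history law: the context of the new round is independent of the
past, and the reward is Bernoulli with the payoff of the chosen arm as its mean. -/
lemma integral_historyLaw_succ (π : Policy.{u} d) (P : Instance d) (t : ℕ)
    {f : π.U × History d (t + 1) → ℝ} (hf : Measurable f) {C : ℝ} (hC : ∀ v, |f v| ≤ C) :
    ∫ v, f v ∂(historyLaw π P (t + 1)) =
      ∫ z, ∑ y : Bool, bern (P.payoff (π.act t z) z.2) y *
        f (z.1.1, Fin.snoc (α := fun _ => Ctx d × Bool) z.1.2 (z.2, y))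
        ∂((historyLaw π P t).prod P.PX) := by
  have hm := measurable_extend_history (d := d) (U := π.U) t
  have hfm : Measurable (fun w : (π.U × History d t) × (Ctx d × Bool) =>
      f (w.1.1, Fin.snoc (α := fun _ => Ctx d × Bool) w.1.2 w.2)) := hf.comp hm
  have hval : ∀ z : (π.U × History d t) × Ctx d,
      ∫ y, f (z.1.1, Fin.snoc (α := fun _ => Ctx d × Bool) z.1.2 (z.2, y))
        ∂(P.reward (π.act t z, z.2)) =
      ∑ y : Bool, bern (P.payoff (π.act t z) z.2) y *
        f (z.1.1, Fin.snoc (α := fun _ => Ctx d × Bool) z.1.2 (z.2, y)) := by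
    intro z
    rw [integral_fintype]
    · simp [reward_real_singleton]
    · exact Integrable.of_finite
  have hstep : ∀ w : π.U × History d t,
      ∫ b, f (w.1, Fin.snoc (α := fun _ => Ctx d × Bool) w.2 b) ∂(roundKernel π P t w) =
      ∫ x, ∑ y : Bool, bern (P.payoff (π.act t (w, x)) x) y *
        f (w.1, Fin.snoc (α := fun _ => Ctx d × Bool) w.2 (x, y)) ∂P.PX := by
    intro w
    unfold roundKernel
    rw [ProbabilityTheory.integral_compProd]
    · simp only [Kernel.const_apply]
      refine integral_congr_ae (Eventually.of_forall fun x => ?_)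
      simpa using hval (w, x)
    · exact integrable_of_bounded (hfm.comp (measurable_const.prodMk measurable_id))
        (fun _ => hC _)
  rw [historyLaw, integral_map hm.aemeasurable hf.aestronglyMeasurable,
    Measure.integral_compProd (integrable_of_bounded hfm (fun _ => hC _))]
  simp_rw [hstep]
  rw [integral_prod]
  have hb : ∀ y : Bool, Measurable fun p : ℝ => bern p y := by
    intro y; cases y <;> simp only [bern] <;> simp <;> fun_prop
  refine integrable_of_bounded (C := 2 * C) ?_ ?_
  · refine Finset.measurable_sum _ fun y _ => Measurable.mul ?_ ?_
    · exact (hb y).comp ((measurable_payoff_uncurry P).comp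
        ((π.measurable_act t).prodMk measurable_snd))
    · exact hfm.comp (measurable_fst.prodMk (measurable_snd.prodMk measurable_const))
  · intro z
    have hp := payoff_nonneg P (π.act t z) z.2
    have hp1 := payoff_le_one P (π.act t z) z.2
    have hC0 : 0 ≤ C := (abs_nonneg _).trans (hC (z.1.1, Fin.snoc z.1.2 (z.2, true)))
    refine (Finset.abs_sum_le_sum_abs _ _).trans ?_
    simp only [Fintype.sum_bool, bern, abs_mul]
    have h1 := hC (z.1.1, Fin.snoc z.1.2 (z.2, true))
    have h2 := hC (z.1.1, Fin.snoc z.1.2 (z.2, false))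
    simp only [if_true, Bool.false_eq_true, if_false]
    rw [abs_of_nonneg hp, abs_of_nonneg (by linarith : 0 ≤ 1 - P.payoff (π.act t z) z.2)]
    have a := mul_le_mul hp1 h1 (abs_nonneg _) zero_le_one
    have b := mul_le_mul (by linarith : 1 - P.payoff (π.act t z) z.2 ≤ 1) h2 (abs_nonneg _) zero_le_one
    linarith

/-! ### Likelihood ratios and the divergence of histories -/

/-- The likelihood ratio of `Q` against `P` (two instances with the same contexts) after `t`
rounds. -/
def likelihoodRatio (π : Policy.{u} d) (P Q : Instance d) : (t : ℕ) → π.U × History d t → ℝ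
  | 0, _ => 1
  | t + 1, v =>
    likelihoodRatio π P Q t (v.1, Fin.init (α := fun _ => Ctx d × Bool) v.2) *
      (bern (Q.payoff (π.act t ((v.1, Fin.init (α := fun _ => Ctx d × Bool) v.2),
          (v.2 (Fin.last t)).1)) (v.2 (Fin.last t)).1) (v.2 (Fin.last t)).2 /
        bern (P.payoff (π.act t ((v.1, Fin.init (α := fun _ => Ctx d × Bool) v.2),
          (v.2 (Fin.last t)).1)) (v.2 (Fin.last t)).1) (v.2 (Fin.last t)).2)

/-- All payoffs are at distance at least `1/4` from `0` and from `1`. -/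
def PayoffsBounded (P : Instance d) : Prop := ∀ k x, 1 / 4 ≤ P.payoff k x ∧ P.payoff k x ≤ 3 / 4

lemma measurable_bern : Measurable (fun py : ℝ × Bool => bern py.1 py.2) := by
  refine measurable_from_prod_countable_left fun y => ?_
  cases y <;> simp only [bern] <;> simp <;> fun_prop

lemma bern_bounds {p : ℝ} (h : 1 / 4 ≤ p ∧ p ≤ 3 / 4) (y : Bool) :
    1 / 4 ≤ bern p y ∧ bern p y ≤ 3 / 4 := by
  cases y <;> simp only [bern] <;> simp <;> constructor <;> linarith [h.1, h.2]

lemma likelihoodRatio_snoc (π : Policy.{u} d) (P Q : Instance d) (t : ℕ) (w : π.U × History d t)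
    (x : Ctx d) (y : Bool) :
    likelihoodRatio π P Q (t + 1) (w.1, Fin.snoc (α := fun _ => Ctx d × Bool) w.2 (x, y)) =
      likelihoodRatio π P Q t w * (bern (Q.payoff (π.act t (w, x)) x) y /
        bern (P.payoff (π.act t (w, x)) x) y) := by
  simp [likelihoodRatio]

lemma measurable_init_history (t : ℕ) :
    Measurable (fun h : History d (t + 1) => (Fin.init (α := fun _ => Ctx d × Bool) h :
      History d t)) :=
  measurable_pi_iff.2 fun i => measurable_pi_apply i.castSucc

lemma measurable_likelihoodRatio (π : Policy.{u} d) (P Q : Instance d) (t : ℕ) :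
    Measurable (likelihoodRatio π P Q t) := by
  induction t with
  | zero => exact measurable_const
  | succ t ih =>
    have hi : Measurable (fun v : π.U × History d (t + 1) =>
        ((v.1, Fin.init (α := fun _ => Ctx d × Bool) v.2) : π.U × History d t)) :=
      measurable_fst.prodMk ((measurable_init_history t).comp measurable_snd)
    have hl : Measurable (fun v : π.U × History d (t + 1) => v.2 (Fin.last t)) :=
      (measurable_pi_apply (Fin.last t)).comp measurable_snd
    have hx := measurable_fst.comp hl
    have hk := (π.measurable_act t).comp (hi.prodMk hx)
    have hb : ∀ R : Instance d, Measurable (fun v : π.U × History d (t + 1) =>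
        bern (R.payoff (π.act t ((v.1, Fin.init (α := fun _ => Ctx d × Bool) v.2),
          (v.2 (Fin.last t)).1)) (v.2 (Fin.last t)).1) (v.2 (Fin.last t)).2) := fun R =>
      measurable_bern.comp (((measurable_payoff_uncurry R).comp (hk.prodMk hx)).prodMk
        (measurable_snd.comp hl))
    exact (ih.comp hi).mul ((hb Q).div (hb P))

lemma likelihoodRatio_bounds (π : Policy.{u} d) {P Q : Instance d} (hP : PayoffsBounded P)
    (hQ : PayoffsBounded Q) (t : ℕ) (w : π.U × History d t) :
    (1 / 3) ^ t ≤ likelihoodRatio π P Q t w ∧ likelihoodRatio π P Q t w ≤ 3 ^ t := by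
  induction t with
  | zero => simp [likelihoodRatio]
  | succ t ih =>
    obtain ⟨h1, h2⟩ := ih (w.1, Fin.init (α := fun _ => Ctx d × Bool) w.2)
    have hr : ∀ (k : Fin 2) (x : Ctx d) (y : Bool),
        1 / 3 ≤ bern (Q.payoff k x) y / bern (P.payoff k x) y ∧
          bern (Q.payoff k x) y / bern (P.payoff k x) y ≤ 3 := by
      intro k x y
      have a := bern_bounds (hP k x) y
      have b := bern_bounds (hQ k x) y
      have : 0 < bern (P.payoff k x) y := by linarith
      rw [le_div_iff₀ this, div_le_iff₀ this]
      constructor <;> linarith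
    rw [likelihoodRatio, pow_succ, pow_succ]
    refine ⟨mul_le_mul h1 (hr _ _ _).1 (by norm_num) (le_trans (by positivity) h1),
      mul_le_mul h2 (hr _ _ _).2 (le_trans (by norm_num) (hr _ _ _).1) (by positivity)⟩

lemma likelihoodRatio_pos (π : Policy.{u} d) {P Q : Instance d} (hP : PayoffsBounded P)
    (hQ : PayoffsBounded Q) (t : ℕ) (w : π.U × History d t) : 0 < likelihoodRatio π P Q t w :=
  lt_of_lt_of_le (by positivity) (likelihoodRatio_bounds π hP hQ t w).1

lemma abs_likelihoodRatio_le (π : Policy.{u} d) {P Q : Instance d} (hP : PayoffsBounded P)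
    (hQ : PayoffsBounded Q) (t : ℕ) (w : π.U × History d t) :
    |likelihoodRatio π P Q t w| ≤ 3 ^ t := by
  rw [abs_of_pos (likelihoodRatio_pos π hP hQ t w)]
  exact (likelihoodRatio_bounds π hP hQ t w).2

lemma abs_log_likelihoodRatio_le (π : Policy.{u} d) {P Q : Instance d} (hP : PayoffsBounded P)
    (hQ : PayoffsBounded Q) (t : ℕ) (w : π.U × History d t) :
    |Real.log (likelihoodRatio π P Q t w)| ≤ t * Real.log 3 := by
  obtain ⟨h1, h2⟩ := likelihoodRatio_bounds π hP hQ t w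
  have h0 := likelihoodRatio_pos π hP hQ t w
  have a := Real.log_le_log (by positivity) h1
  have b := Real.log_le_log h0 h2
  rw [Real.log_pow] at a b
  rw [one_div, Real.log_inv] at a
  exact abs_le.2 ⟨by linarith, b⟩

/-- A change of measure on histories extends to the histories with the context of the next round,
which is independent of the past. -/
lemma integral_prod_of_integral_history (π : Policy.{u} d) {P Q : Instance d}
    (hX : Q.PX = P.PX) (hP : PayoffsBounded P) (hQ : PayoffsBounded Q) (t : ℕ)
    (ih : ∀ f : π.U × History d t → ℝ, Measurable f → ∀ C : ℝ, (∀ v, |f v| ≤ C) →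
      ∫ v, f v ∂(historyLaw π Q t) = ∫ v, likelihoodRatio π P Q t v * f v ∂(historyLaw π P t))
    {f : (π.U × History d t) × Ctx d → ℝ} (hf : Measurable f) {C : ℝ} (hC : ∀ v, |f v| ≤ C) :
    ∫ z, f z ∂((historyLaw π Q t).prod Q.PX) =
      ∫ z, likelihoodRatio π P Q t z.1 * f z ∂((historyLaw π P t).prod P.PX) := by
  have hL := measurable_likelihoodRatio π P Q t
  rw [integral_prod _ (integrable_of_bounded hf hC), integral_prod, hX]
  · rw [ih _ (hf.stronglyMeasurable.integral_prod_right' (ν := P.PX)).measurable C]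
    · simp_rw [integral_const_mul]
    · intro v
      rw [← Real.norm_eq_abs]
      refine (norm_integral_le_of_norm_le_const (C := C) (Eventually.of_forall fun x => ?_)).trans ?_
      · exact hC _
      · simp
  · refine integrable_of_bounded ((hL.comp measurable_fst).mul hf) (C := 3 ^ t * C) fun z => ?_
    rw [abs_mul]
    exact mul_le_mul (abs_likelihoodRatio_le π hP hQ t _) (hC z) (abs_nonneg _) (by positivity)

lemma measurable_bern_payoff_act (π : Policy.{u} d) (P : Instance d) (t : ℕ) (y : Bool) :
    Measurable (fun z : (π.U × History d t) × Ctx d => bern (P.payoff (π.act t z) z.2) y) :=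
  measurable_bern.comp (((measurable_payoff_uncurry P).comp
    ((π.measurable_act t).prodMk measurable_snd)).prodMk measurable_const)

lemma abs_sum_bern_mul_le {p : ℝ} (h : 1 / 4 ≤ p ∧ p ≤ 3 / 4) {g : Bool → ℝ} {C : ℝ}
    (hg : ∀ y, |g y| ≤ C) : |∑ y : Bool, bern p y * g y| ≤ C := by
  simp only [Fintype.sum_bool, bern, if_true, Bool.false_eq_true, if_false]
  have h1 := abs_le.1 (hg true)
  have h2 := abs_le.1 (hg false)
  rw [abs_le]
  constructor <;> nlinarith [h.1, h.2]

/-- Change of measure on histories. -/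
lemma integral_historyLaw_eq (π : Policy.{u} d) {P Q : Instance d}
    (hX : Q.PX = P.PX) (hP : PayoffsBounded P) (hQ : PayoffsBounded Q) (t : ℕ) :
    ∀ f : π.U × History d t → ℝ, Measurable f → ∀ C : ℝ, (∀ v, |f v| ≤ C) →
      ∫ v, f v ∂(historyLaw π Q t) =
        ∫ v, likelihoodRatio π P Q t v * f v ∂(historyLaw π P t) := by
  induction t with
  | zero => intro f _ C _; simp [likelihoodRatio, historyLaw]
  | succ t ih =>
    intro f hf C hC
    have hL := measurable_likelihoodRatio π P Q (t + 1)
    rw [integral_historyLaw_succ π Q t hf hC,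
      integral_historyLaw_succ π P t (f := fun v => likelihoodRatio π P Q (t + 1) v * f v)
        (hL.mul hf) (C := 3 ^ (t + 1) * C)]
    · rw [integral_prod_of_integral_history π hX hP hQ t ih (C := C)]
      · refine integral_congr_ae (Eventually.of_forall fun z => ?_)
        simp only [Finset.mul_sum, likelihoodRatio_snoc π P Q t z.1 z.2]
        refine Finset.sum_congr rfl fun y _ => ?_
        have := bern_bounds (hP (π.act t z) z.2) y
        have h0 : bern (P.payoff (π.act t z) z.2) y ≠ 0 := by linarith
        field_simp
      · refine Finset.measurable_sum _ fun y _ => (measurable_bern_payoff_act π Q t y).mul ?_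
        exact hf.comp ((measurable_extend_history t).comp
          (measurable_fst.prodMk (measurable_snd.prodMk measurable_const)))
      · exact fun z => abs_sum_bern_mul_le (hQ _ _) fun y => hC _
    · intro v
      rw [abs_mul]
      exact mul_le_mul (abs_likelihoodRatio_le π hP hQ _ _) (hC v) (abs_nonneg _) (by positivity)

/-- Change of measure on histories together with the context of the next round. -/
lemma integral_historyLaw_prod_eq (π : Policy.{u} d) {P Q : Instance d}
    (hX : Q.PX = P.PX) (hP : PayoffsBounded P) (hQ : PayoffsBounded Q) (t : ℕ)
    {f : (π.U × History d t) × Ctx d → ℝ} (hf : Measurable f) {C : ℝ} (hC : ∀ v, |f v| ≤ C) :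
    ∫ z, f z ∂((historyLaw π Q t).prod Q.PX) =
      ∫ z, likelihoodRatio π P Q t z.1 * f z ∂((historyLaw π P t).prod P.PX) :=
  integral_prod_of_integral_history π hX hP hQ t (integral_historyLaw_eq π hX hP hQ t) hf hC

/-- The probability that the second arm is chosen in the round that follows `t` completed rounds,
at a context in `B`. -/
def pullProb (π : Policy.{u} d) (P : Instance d) (B : Set (Ctx d)) (t : ℕ) : ℝ :=
  ((historyLaw π P t).prod P.PX).real {z | z.2 ∈ B ∧ π.act t z = 1}

lemma measurableSet_pull (π : Policy.{u} d) {B : Set (Ctx d)} (hB : MeasurableSet B) (t : ℕ)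
    (k : Fin 2) : MeasurableSet {z : (π.U × History d t) × Ctx d | z.2 ∈ B ∧ π.act t z = k} :=
  (measurable_snd hB).inter (π.measurable_act t (MeasurableSet.singleton k))

/-- The Kullback-Leibler divergence of two Bernoulli laws is at most their `χ²`-divergence. -/
lemma bern_kl_le {p q : ℝ} (hp : 1 / 4 ≤ p ∧ p ≤ 3 / 4) (hq : 1 / 4 ≤ q ∧ q ≤ 3 / 4) :
    ∑ y : Bool, bern p y * (-Real.log (bern q y / bern p y)) ≤ 6 * (p - q) ^ 2 := by
  simp only [Fintype.sum_bool, bern, if_true, Bool.false_eq_true, if_false]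
  have key : ∀ a b : ℝ, 0 < a → 0 < b → -Real.log (b / a) ≤ a / b - 1 := by
    intro a b ha hb
    rw [← Real.log_inv, inv_div]
    exact Real.log_le_sub_one_of_pos (by positivity)
  have h1 := key p q (by linarith) (by linarith)
  have h2 := key (1 - p) (1 - q) (by linarith) (by linarith)
  have hq0 : 0 < q := by linarith
  have hq1 : 0 < 1 - q := by linarith
  have e : p * (p / q - 1) + (1 - p) * ((1 - p) / (1 - q) - 1) = (p - q) ^ 2 / (q * (1 - q)) := by
    field_simp; ring
  have h3 : (p - q) ^ 2 / (q * (1 - q)) ≤ 6 * (p - q) ^ 2 := by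
    rw [div_le_iff₀ (by positivity)]
    have : 1 / 6 ≤ q * (1 - q) := by nlinarith
    nlinarith [sq_nonneg (p - q)]
  nlinarith

/-- The divergence of the histories is at most the squared gap times the number of informative
rounds. -/
lemma integral_neg_log_likelihoodRatio_le (π : Policy.{u} d) {P Q : Instance d}
    (hP : PayoffsBounded P) (hQ : PayoffsBounded Q)
    (h0 : ∀ x, Q.payoff 0 x = P.payoff 0 x) {B : Set (Ctx d)} (hB : MeasurableSet B)
    (h1 : ∀ x ∉ B, Q.payoff 1 x = P.payoff 1 x) {η : ℝ}
    (h2 : ∀ x, |P.payoff 1 x - Q.payoff 1 x| ≤ η) (t : ℕ) :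
    ∫ v, -Real.log (likelihoodRatio π P Q t v) ∂(historyLaw π P t) ≤
      6 * η ^ 2 * ∑ s ∈ Finset.range t, pullProb π P B s := by
  induction t with
  | zero => simp [likelihoodRatio]
  | succ t ih =>
    have hLm := (measurable_likelihoodRatio π P Q (t + 1)).log.neg
    rw [integral_historyLaw_succ π P t (f := fun v => -Real.log (likelihoodRatio π P Q (t + 1) v))
      hLm (C := ((t + 1 : ℕ) : ℝ) * Real.log 3)
      (fun v => by rw [abs_neg]; exact abs_log_likelihoodRatio_le π hP hQ _ _),
      Finset.sum_range_succ, mul_add]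
    set S : Set ((π.U × History d t) × Ctx d) := {z | z.2 ∈ B ∧ π.act t z = 1} with hS
    have hSm : MeasurableSet S := measurableSet_pull π hB t 1
    have hpt : ∀ z : (π.U × History d t) × Ctx d,
        ∑ y : Bool, bern (P.payoff (π.act t z) z.2) y *
          (-Real.log (likelihoodRatio π P Q (t + 1)
            (z.1.1, Fin.snoc (α := fun _ => Ctx d × Bool) z.1.2 (z.2, y)))) ≤
        -Real.log (likelihoodRatio π P Q t z.1) + S.indicator (fun _ => 6 * η ^ 2) z := by
      intro z
      have hL0 := likelihoodRatio_pos π hP hQ t z.1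
      have hsplit : ∀ y : Bool, -Real.log (likelihoodRatio π P Q (t + 1)
            (z.1.1, Fin.snoc (α := fun _ => Ctx d × Bool) z.1.2 (z.2, y))) =
          -Real.log (likelihoodRatio π P Q t z.1) +
            (-Real.log (bern (Q.payoff (π.act t z) z.2) y / bern (P.payoff (π.act t z) z.2) y)) := by
        intro y
        have a := bern_bounds (hP (π.act t z) z.2) y
        have b := bern_bounds (hQ (π.act t z) z.2) y
        rw [likelihoodRatio_snoc π P Q t z.1 z.2, Real.log_mul hL0.ne']
        · ring
        · exact (div_pos (by linarith) (by linarith)).ne'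
      simp_rw [hsplit, mul_add, Finset.sum_add_distrib, ← Finset.sum_mul]
      have hsum : ∀ p : ℝ, ∑ y : Bool, bern p y = 1 := by intro p; simp [bern]
      rw [hsum, one_mul]
      gcongr
      have hkl := bern_kl_le (hP (π.act t z) z.2) (hQ (π.act t z) z.2)
      refine hkl.trans ?_
      by_cases hz : z ∈ S
      · rw [Set.indicator_of_mem hz, hz.2]
        have := sq_le_sq' (by linarith [abs_le.1 (h2 z.2)]) (abs_le.1 (h2 z.2)).2
        linarith
      · rw [Set.indicator_of_notMem hz]
        have : Q.payoff (π.act t z) z.2 = P.payoff (π.act t z) z.2 := by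
          by_cases hk : π.act t z = 1
          · rw [hk]; exact h1 _ fun hb => hz ⟨hb, hk⟩
          · have : π.act t z = 0 := by omega
            rw [this]; exact h0 _
        simp [this]
    have hi1 : Integrable (fun z : (π.U × History d t) × Ctx d =>
        -Real.log (likelihoodRatio π P Q t z.1)) ((historyLaw π P t).prod P.PX) :=
      integrable_of_bounded (((measurable_likelihoodRatio π P Q t).comp measurable_fst).log.neg)
        (C := t * Real.log 3)
        (fun v => by rw [abs_neg]; exact abs_log_likelihoodRatio_le π hP hQ _ _)
    have hi2 : Integrable (S.indicator (fun _ => 6 * η ^ 2)) ((historyLaw π P t).prod P.PX) :=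
      (integrable_const _).indicator hSm
    calc _ ≤ ∫ z, (-Real.log (likelihoodRatio π P Q t z.1) + S.indicator (fun _ => 6 * η ^ 2) z)
          ∂((historyLaw π P t).prod P.PX) := by
          refine integral_mono ?_ (hi1.add hi2) hpt
          refine integrable_of_bounded ?_ (C := ((t + 1 : ℕ) : ℝ) * Real.log 3) fun z =>
            abs_sum_bern_mul_le (hP _ _) fun y => ?_
          · refine Finset.measurable_sum _ fun y _ => (measurable_bern_payoff_act π P t y).mul ?_
            exact hLm.comp ((measurable_extend_history t).comp
              (measurable_fst.prodMk (measurable_snd.prodMk measurable_const)))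
          · rw [abs_neg]; exact abs_log_likelihoodRatio_le π hP hQ _ _
      _ = ∫ v, -Real.log (likelihoodRatio π P Q t v) ∂(historyLaw π P t) +
          6 * η ^ 2 * pullProb π P B t := by
          rw [integral_add hi1 hi2, integral_indicator_const _ hSm, smul_eq_mul]
          congr 1
          · have := integral_prod_mul (μ := historyLaw π P t) (ν := P.PX)
              (fun v => -Real.log (likelihoodRatio π P Q t v)) (fun _ => (1 : ℝ))
            simpa using this
          · rw [pullProb, mul_comm]
      _ ≤ _ := by linarith

/-- A pointwise form of a weak Pinsker inequality, based on `log a = 2 log √a ≤ 2 (√a - 1)`. Averaged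
over a likelihood ratio, it bounds the total variation distance by the divergence. -/
lemma max_one_sub_le {a : ℝ} (ha : 0 < a) :
    max (1 - a) 0 ≤ 1 / 4 + 4 * (-Real.log a + a - 1) := by
  have hs := Real.sqrt_nonneg a
  have hsp : 0 < √a := Real.sqrt_pos.2 ha
  have hsq := Real.sq_sqrt ha.le
  have h1 := Real.log_le_sub_one_of_pos hsp
  rw [Real.log_sqrt ha.le] at h1
  have h2 : (1 - √a) ^ 2 ≤ -Real.log a + a - 1 := by nlinarith
  refine max_le ?_ (by nlinarith [sq_nonneg (1 - √a)])
  nlinarith [sq_nonneg (2 * (1 - √a) - 1 / 2), sq_nonneg (1 - √a)]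

lemma integral_max_one_sub_le (π : Policy.{u} d) {P Q : Instance d} (hX : Q.PX = P.PX)
    (hP : PayoffsBounded P) (hQ : PayoffsBounded Q) (t : ℕ) :
    ∫ v, max (1 - likelihoodRatio π P Q t v) 0 ∂(historyLaw π P t) ≤
      1 / 4 + 4 * ∫ v, -Real.log (likelihoodRatio π P Q t v) ∂(historyLaw π P t) := by
  have hL := measurable_likelihoodRatio π P Q t
  have hLi : Integrable (likelihoodRatio π P Q t) (historyLaw π P t) :=
    integrable_of_bounded hL (abs_likelihoodRatio_le π hP hQ t)
  have hlog : Integrable (fun v => -Real.log (likelihoodRatio π P Q t v)) (historyLaw π P t) :=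
    integrable_of_bounded hL.log.neg (C := t * Real.log 3)
      (fun v => by rw [abs_neg]; exact abs_log_likelihoodRatio_le π hP hQ _ _)
  have h1 : ∫ v, likelihoodRatio π P Q t v ∂(historyLaw π P t) = 1 := by
    have := integral_historyLaw_eq π hX hP hQ t (fun _ => 1) measurable_const 1 (by simp)
    simpa using this.symm
  calc _ ≤ ∫ v, (1 / 4 + 4 * (-Real.log (likelihoodRatio π P Q t v) +
        likelihoodRatio π P Q t v - 1)) ∂(historyLaw π P t) := by
        refine integral_mono (((integrable_const 1).sub hLi).sup (integrable_const 0)) ?_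
          fun v => max_one_sub_le (likelihoodRatio_pos π hP hQ t v)
        exact (integrable_const _).add (((hlog.add hLi).sub (integrable_const 1)).const_mul 4)
    _ = _ := by
        have i1 : Integrable (fun v => -Real.log (likelihoodRatio π P Q t v) +
            likelihoodRatio π P Q t v) (historyLaw π P t) := hlog.add hLi
        have i2 : Integrable (fun v => -Real.log (likelihoodRatio π P Q t v) +
            likelihoodRatio π P Q t v - 1) (historyLaw π P t) := i1.sub (integrable_const 1)
        rw [integral_add (integrable_const _) (i2.const_mul 4), integral_const_mul,
          integral_sub i1 (integrable_const 1), integral_add hlog hLi, h1]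
        simp

/-! ### Lower bounds from indistinguishable instances -/

lemma measurable_roundRegret (π : Policy.{u} d) (P : Instance d) (t : ℕ) :
    Measurable (fun w : (π.U × History d t) × Ctx d =>
      max (P.payoff 0 w.2) (P.payoff 1 w.2) - P.payoff (π.act t w) w.2) :=
  (((measurable_payoff P 0).comp measurable_snd).max
    ((measurable_payoff P 1).comp measurable_snd)).sub
      ((measurable_payoff_uncurry P).comp ((π.measurable_act t).prodMk measurable_snd))

lemma roundRegret_nonneg (P : Instance d) (k : Fin 2) (x : Ctx d) :
    0 ≤ max (P.payoff 0 x) (P.payoff 1 x) - P.payoff k x := by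
  rw [sub_nonneg]
  have : k = 0 ∨ k = 1 := by omega
  rcases this with rfl | rfl
  · exact le_max_left _ _
  · exact le_max_right _ _

lemma mul_measureReal_le_integral_roundRegret (π : Policy.{u} d) (P : Instance d) (t : ℕ)
    {S : Set ((π.U × History d t) × Ctx d)} (hS : MeasurableSet S) {c : ℝ}
    (hc : ∀ w ∈ S, c ≤ max (P.payoff 0 w.2) (P.payoff 1 w.2) - P.payoff (π.act t w) w.2) :
    c * ((historyLaw π P t).prod P.PX).real S ≤
      ∫ w, (max (P.payoff 0 w.2) (P.payoff 1 w.2) - P.payoff (π.act t w) w.2)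
        ∂((historyLaw π P t).prod P.PX) := by
  calc _ = ∫ w, S.indicator (fun _ => c) w ∂((historyLaw π P t).prod P.PX) := by
        rw [integral_indicator_const _ hS, smul_eq_mul, mul_comm]
    _ ≤ _ := by
        refine integral_mono ((integrable_const c).indicator hS)
          (integrable_of_bounded (measurable_roundRegret π P t) (C := 1) fun w => ?_) fun w => ?_
        · rw [abs_of_nonneg (roundRegret_nonneg P _ _)]
          have h1 := payoff_nonneg P (π.act t w) w.2
          have h2 := max_le (payoff_le_one P 0 w.2) (payoff_le_one P 1 w.2)
          linarith
        · by_cases h : w ∈ S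
          · rw [Set.indicator_of_mem h]; exact hc w h
          · rw [Set.indicator_of_notMem h]; exact roundRegret_nonneg P _ _

lemma mul_sum_pullProb_le_regret (π : Policy.{u} d) (P : Instance d) (T : ℕ) {Δ : ℝ}
    {B : Set (Ctx d)} (hB : MeasurableSet B)
    (hΔ : ∀ x ∈ B, Δ ≤ P.payoff 0 x - P.payoff 1 x) :
    Δ * ∑ t ∈ Finset.range T, pullProb π P B t ≤ regret π P T := by
  rw [regret, Finset.mul_sum]
  refine Finset.sum_le_sum fun t _ =>
    mul_measureReal_le_integral_roundRegret π P t (measurableSet_pull π hB t 1) fun w hw => ?_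
  rw [hw.2]
  exact (hΔ _ hw.1).trans (sub_le_sub_right (le_max_left _ _) _)

lemma sum_pullProb_eq (π : Policy.{u} d) (P : Instance d) (t : ℕ) {ι : Type*} [Fintype ι]
    {B : ι → Set (Ctx d)} (hB : ∀ j, MeasurableSet (B j))
    (hd : Pairwise fun i j => Disjoint (B i) (B j)) :
    ∑ j, pullProb π P (B j) t = pullProb π P (⋃ j, B j) t := by
  have e : {z : (π.U × History d t) × Ctx d | z.2 ∈ ⋃ j, B j ∧ π.act t z = 1} =
      ⋃ j, {z | z.2 ∈ B j ∧ π.act t z = 1} := by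
    ext z; simp
  simp only [pullProb]
  rw [e, measureReal_iUnion_fintype]
  · exact fun i j hij => Set.disjoint_left.2 fun z hz hz' =>
      Set.disjoint_left.1 (hd hij) hz.1 hz'.1
  · exact fun j => measurableSet_pull π (hB j) t 1

/-- Pigeonhole: among `M` disjoint cells on which the second arm costs at least `Δ`, some cell is
explored at most `regret / (Δ M)` times. -/
lemma exists_rarely_explored_cell (π : Policy.{u} d) (P : Instance d) (T : ℕ) {ι : Type*}
    [Fintype ι] [Nonempty ι] {B : ι → Set (Ctx d)} (hB : ∀ j, MeasurableSet (B j))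
    (hd : Pairwise fun i j => Disjoint (B i) (B j)) {Δ : ℝ}
    (hg : ∀ j, ∀ x ∈ B j, Δ ≤ P.payoff 0 x - P.payoff 1 x) :
    ∃ j, Δ * Fintype.card ι * ∑ t ∈ Finset.range T, pullProb π P (B j) t ≤ regret π P T := by
  have h1 := mul_sum_pullProb_le_regret π P T (MeasurableSet.iUnion hB) (Δ := Δ)
    (fun x hx => by obtain ⟨j, hj⟩ := Set.mem_iUnion.1 hx; exact hg j x hj)
  simp_rw [← sum_pullProb_eq π P _ hB hd] at h1
  rw [Finset.sum_comm, Finset.mul_sum] at h1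
  by_contra! h
  have h2 : ∑ _j : ι, regret π P T < ∑ j, Δ * Fintype.card ι *
      ∑ t ∈ Finset.range T, pullProb π P (B j) t :=
    Finset.sum_lt_sum_of_nonempty Finset.univ_nonempty fun j _ => h j
  have hM : (0 : ℝ) < Fintype.card ι := by exact_mod_cast Fintype.card_pos
  have h3 : ∑ j, Δ * Fintype.card ι * ∑ t ∈ Finset.range T, pullProb π P (B j) t =
      Fintype.card ι * ∑ j, Δ * ∑ t ∈ Finset.range T, pullProb π P (B j) t := by
    rw [Finset.mul_sum]; exact Finset.sum_congr rfl fun j _ => by ring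
  rw [h3, Finset.sum_const, Finset.card_univ, nsmul_eq_mul] at h2
  exact absurd (lt_of_mul_lt_mul_left h2 hM.le) (not_lt.2 h1)

/-- Two instances that differ only by the payoff of the second arm on `B`: if the policy rarely
tries the second arm on `B` under `P`, it cannot notice the difference, and it has a large regret
under `P` (where the second arm is inferior on `B`) or under `Q` (where it is superior on
`B'`). The assumption on the number of pulls bounds the divergence of the histories by `1/16`, hence
their total variation distance by `1/2`. -/
theorem two_instance_lower_bound (π : Policy.{u} d) {P Q : Instance d} (T : ℕ)
    (hX : Q.PX = P.PX) (hP : PayoffsBounded P) (hQ : PayoffsBounded Q)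
    (h0 : ∀ x, Q.payoff 0 x = P.payoff 0 x) {B B' : Set (Ctx d)} (hB : MeasurableSet B)
    (hB' : MeasurableSet B') (hBB : B' ⊆ B) (h1 : ∀ x ∉ B, Q.payoff 1 x = P.payoff 1 x) {Δ : ℝ}
    (hΔ : 0 ≤ Δ) (h2 : ∀ x, |P.payoff 1 x - Q.payoff 1 x| ≤ 2 * Δ)
    (hgP : ∀ x ∈ B, Δ ≤ P.payoff 0 x - P.payoff 1 x)
    (hgQ : ∀ x ∈ B', Δ / 2 ≤ Q.payoff 1 x - Q.payoff 0 x)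
    (hN : 24 * Δ ^ 2 * ∑ t ∈ Finset.range T, pullProb π P B t ≤ 1 / 16) :
    Δ / 4 * (T * P.PX.real B') ≤ regret π P T + regret π Q T := by
  have hround : ∀ t < T, Δ / 2 * (P.PX.real B' / 2 - pullProb π P B t) ≤
      ∫ w, (max (Q.payoff 0 w.2) (Q.payoff 1 w.2) - Q.payoff (π.act t w) w.2)
        ∂((historyLaw π Q t).prod Q.PX) := by
    intro t ht
    have hL := measurable_likelihoodRatio π P Q t
    set S : Set ((π.U × History d t) × Ctx d) := {z | z.2 ∈ B' ∧ π.act t z = 0} with hS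
    have hSm : MeasurableSet S := measurableSet_pull π hB' t 0
    have hTV : ∫ v, max (1 - likelihoodRatio π P Q t v) 0 ∂(historyLaw π P t) ≤ 1 / 2 := by
      have a := integral_max_one_sub_le π hX hP hQ t
      have b := integral_neg_log_likelihoodRatio_le π hP hQ h0 hB h1 h2 t
      have c : ∑ s ∈ Finset.range t, pullProb π P B s ≤ ∑ s ∈ Finset.range T, pullProb π P B s :=
        Finset.sum_le_sum_of_subset_of_nonneg (Finset.range_mono ht.le)
          fun _ _ _ => measureReal_nonneg
      have e := mul_le_mul_of_nonneg_left c (by positivity : 0 ≤ 24 * Δ ^ 2)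
      nlinarith
    have hmaxi : Integrable (fun z : (π.U × History d t) × Ctx d =>
        max (1 - likelihoodRatio π P Q t z.1) 0 * B'.indicator (fun _ => (1 : ℝ)) z.2)
        ((historyLaw π P t).prod P.PX) := by
      refine integrable_of_bounded (C := 1) ?_ fun z => ?_
      · exact ((measurable_const.sub (hL.comp measurable_fst)).max measurable_const).mul
          ((measurable_const.indicator hB').comp measurable_snd)
      · have hp := likelihoodRatio_pos π hP hQ t z.1
        have hm : |max (1 - likelihoodRatio π P Q t z.1) 0| ≤ 1 := by
          rw [abs_of_nonneg (le_max_right _ _)]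
          exact max_le (by linarith) zero_le_one
        rw [abs_mul]
        refine mul_le_one₀ hm (abs_nonneg _) ?_
        by_cases h : z.2 ∈ B' <;> simp [h]
    -- The context is independent of the history, so the error of the change of measure on `S` is
    -- the total variation distance times the mass of `B'`, not the former alone.
    have hQS : ((historyLaw π P t).prod P.PX).real S - P.PX.real B' / 2 ≤
        ((historyLaw π Q t).prod Q.PX).real S := by
      have e1 : ((historyLaw π Q t).prod Q.PX).real S = ∫ z, likelihoodRatio π P Q t z.1 *
          S.indicator (fun _ => (1 : ℝ)) z ∂((historyLaw π P t).prod P.PX) := by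
        rw [← integral_historyLaw_prod_eq π hX hP hQ t (measurable_const.indicator hSm) (C := 1),
          integral_indicator_const _ hSm, smul_eq_mul, mul_one]
        intro z
        by_cases h : z ∈ S <;> simp [h]
      have e2 : ∫ z, max (1 - likelihoodRatio π P Q t z.1) 0 * B'.indicator (fun _ => (1 : ℝ)) z.2
          ∂((historyLaw π P t).prod P.PX) ≤ P.PX.real B' / 2 := by
        rw [integral_prod_mul (fun v => max (1 - likelihoodRatio π P Q t v) 0)
          (fun x => B'.indicator (fun _ => (1 : ℝ)) x), integral_indicator_const _ hB', smul_eq_mul,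
          mul_one]
        nlinarith [measureReal_nonneg (μ := P.PX) (s := B')]
      have e3 : ((historyLaw π P t).prod P.PX).real S =
          ∫ z, S.indicator (fun _ => (1 : ℝ)) z ∂((historyLaw π P t).prod P.PX) := by
        rw [integral_indicator_const _ hSm, smul_eq_mul, mul_one]
      have hSi : Integrable (S.indicator (fun _ => (1 : ℝ))) ((historyLaw π P t).prod P.PX) :=
        (integrable_const _).indicator hSm
      have e4 := integral_sub hSi hmaxi
      have e5 : ∫ z, (S.indicator (fun _ => (1 : ℝ)) z - max (1 - likelihoodRatio π P Q t z.1) 0 *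
            B'.indicator (fun _ => (1 : ℝ)) z.2) ∂((historyLaw π P t).prod P.PX) ≤
          ∫ z, likelihoodRatio π P Q t z.1 * S.indicator (fun _ => (1 : ℝ)) z
            ∂((historyLaw π P t).prod P.PX) := by
        refine integral_mono (hSi.sub hmaxi) ?_ fun z => ?_
        · refine integrable_of_bounded ((hL.comp measurable_fst).mul
            (measurable_const.indicator hSm)) (C := 3 ^ t) fun z => ?_
          rw [abs_mul]
          have a := abs_likelihoodRatio_le π hP hQ t z.1
          have b : |S.indicator (fun _ => (1 : ℝ)) z| ≤ 1 := by
            by_cases h : z ∈ S <;> simp [h]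
          calc _ ≤ (3 : ℝ) ^ t * 1 := mul_le_mul a b (abs_nonneg _) (by positivity)
            _ = _ := mul_one _
        · have hp := likelihoodRatio_pos π hP hQ t z.1
          by_cases h : z ∈ S
          · simp only [Set.indicator_of_mem h, Set.indicator_of_mem h.1]
            linarith [le_max_left (1 - likelihoodRatio π P Q t z.1) 0]
          · simp only [Set.indicator_of_notMem h, mul_zero, zero_sub, neg_nonpos]
            exact mul_nonneg (le_max_right _ _) (Set.indicator_nonneg (fun _ _ => zero_le_one) _)
      linarith
    have hPS : P.PX.real B' - pullProb π P B t ≤ ((historyLaw π P t).prod P.PX).real S := by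
      have e1 : ((historyLaw π P t).prod P.PX).real (Set.univ ×ˢ B') = P.PX.real B' := by
        rw [measureReal_prod_prod]; simp
      have e2 : (Set.univ ×ˢ B' : Set ((π.U × History d t) × Ctx d)) ⊆
          S ∪ {z | z.2 ∈ B ∧ π.act t z = 1} := by
        rintro z ⟨-, hz⟩
        by_cases hk : π.act t z = 1
        · exact Or.inr ⟨hBB hz, hk⟩
        · exact Or.inl ⟨hz, by omega⟩
      have e3 := (measureReal_mono (μ := (historyLaw π P t).prod P.PX) e2).trans
        (measureReal_union_le _ _)
      rw [e1] at e3
      rw [pullProb]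
      linarith
    have hfin := mul_measureReal_le_integral_roundRegret π Q t hSm (c := Δ / 2) fun w hw => by
      rw [hw.2]
      exact (hgQ _ hw.1).trans (sub_le_sub_right (le_max_right _ _) _)
    refine le_trans (mul_le_mul_of_nonneg_left ?_ (by linarith)) hfin
    linarith
  have hQr : Δ / 2 * (T * (P.PX.real B' / 2) - ∑ t ∈ Finset.range T, pullProb π P B t) ≤
      regret π Q T := by
    calc _ = ∑ t ∈ Finset.range T, Δ / 2 * (P.PX.real B' / 2 - pullProb π P B t) := by
          rw [← Finset.mul_sum, Finset.sum_sub_distrib]; simp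
      _ ≤ _ := Finset.sum_le_sum fun t ht => hround t (Finset.mem_range.1 ht)
  have hPr := mul_sum_pullProb_le_regret π P T hB hgP
  have hn : 0 ≤ Δ * ∑ t ∈ Finset.range T, pullProb π P B t :=
    mul_nonneg hΔ (Finset.sum_nonneg fun _ _ => measureReal_nonneg)
  nlinarith

/-- If `P` belongs to both classes, each `Q j` belongs to the class `S'`, and the regret over the
class `S` is at most `R`, too small for an exploration of all cells, then the regret over `S'` is
large. The constant `384` is `24 * 16`: some cell receives at most `R / (Δ M)` pulls, `M` being the
number of cells, and `two_instance_lower_bound` asks for at most `1 / (384 Δ²)`. -/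
theorem worstRegret_lower_bound (π : Policy.{u} d) {P : Instance d} {ι : Type*} [Fintype ι]
    [Nonempty ι] {Q : ι → Instance d} {S S' : Set (Instance d)} (T : ℕ)
    (hPS : P ∈ S) (hPS' : P ∈ S') (hQS' : ∀ j, Q j ∈ S')
    (hX : ∀ j, (Q j).PX = P.PX) (hP : PayoffsBounded P) (hQ : ∀ j, PayoffsBounded (Q j))
    (h0 : ∀ j x, (Q j).payoff 0 x = P.payoff 0 x) {B B' : ι → Set (Ctx d)}
    (hB : ∀ j, MeasurableSet (B j)) (hd : Pairwise fun i j => Disjoint (B i) (B j))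
    (hB' : ∀ j, MeasurableSet (B' j)) (hBB : ∀ j, B' j ⊆ B j)
    (h1 : ∀ j, ∀ x ∉ B j, (Q j).payoff 1 x = P.payoff 1 x) {Δ : ℝ}
    (hΔ : 0 < Δ) (h2 : ∀ j x, |P.payoff 1 x - (Q j).payoff 1 x| ≤ 2 * Δ)
    (hgP : ∀ j, ∀ x ∈ B j, Δ ≤ P.payoff 0 x - P.payoff 1 x)
    (hgQ : ∀ j, ∀ x ∈ B' j, Δ / 2 ≤ (Q j).payoff 1 x - (Q j).payoff 0 x)
    {m R : ℝ} (hm : ∀ j, m ≤ P.PX.real (B' j))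
    (hR : worstRegret π S T ≤ (R : EReal)) (hΔR : 384 * Δ * R ≤ Fintype.card ι) :
    ((Δ / 8 * (T * m) : ℝ) : EReal) ≤ worstRegret π S' T := by
  have hRP : regret π P T ≤ R := by
    have : (regret π P T : EReal) ≤ worstRegret π S T :=
      le_iSup₂_of_le (f := fun P (_ : P ∈ S) => (regret π P T : EReal)) P hPS le_rfl
    exact EReal.coe_le_coe_iff.1 (this.trans hR)
  obtain ⟨j, hj⟩ := exists_rarely_explored_cell π P T hB hd hgP
  have hM : (0 : ℝ) < Fintype.card ι := by exact_mod_cast Fintype.card_pos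
  have hN : 24 * Δ ^ 2 * ∑ t ∈ Finset.range T, pullProb π P (B j) t ≤ 1 / 16 := by
    have a := mul_le_mul_of_nonneg_left (hj.trans hRP) hΔ.le
    have b : (24 * Δ ^ 2 * ∑ t ∈ Finset.range T, pullProb π P (B j) t) * Fintype.card ι ≤
        1 / 16 * Fintype.card ι := by nlinarith
    exact le_of_mul_le_mul_right b hM
  have key := two_instance_lower_bound π T (hX j) hP (hQ j) (h0 j) (hB j) (hB' j) (hBB j) (h1 j)
    hΔ.le (h2 j) (hgP j) (hgQ j) hN
  have hTm : Δ / 4 * (T * m) ≤ Δ / 4 * (T * P.PX.real (B' j)) := by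
    have := hm j
    gcongr
  have hor : Δ / 8 * (T * m) ≤ regret π P T ∨ Δ / 8 * (T * m) ≤ regret π (Q j) T := by
    by_contra! h
    linarith [h.1, h.2]
  rcases hor with h | h
  · exact le_iSup₂_of_le (f := fun P (_ : P ∈ S') => (regret π P T : EReal)) P hPS'
      (EReal.coe_le_coe_iff.2 h)
  · exact le_iSup₂_of_le (f := fun P (_ : P ∈ S') => (regret π P T : EReal)) (Q j) (hQS' j)
      (EReal.coe_le_coe_iff.2 h)

/-! ### Powers of the positive part and the Hölder condition on the cube -/

/-- The power of the positive part, `v ↦ (v₊) ^ p`. -/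
def posPow (p v : ℝ) : ℝ := max v 0 ^ p

lemma posPow_nonneg (p v : ℝ) : 0 ≤ posPow p v := Real.rpow_nonneg (le_max_right _ _) _

lemma posPow_of_nonneg {p v : ℝ} (hv : 0 ≤ v) : posPow p v = v ^ p := by
  rw [posPow, max_eq_left hv]

lemma posPow_of_nonpos {p v : ℝ} (hp : p ≠ 0) (hv : v ≤ 0) : posPow p v = 0 := by
  rw [posPow, max_eq_right hv, Real.zero_rpow hp]

lemma posPow_le_one {p v : ℝ} (hp : 0 ≤ p) (hv : v ≤ 1) : posPow p v ≤ 1 :=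
  Real.rpow_le_one (le_max_right _ _) (max_le hv zero_le_one) hp

lemma continuous_posPow {p : ℝ} (hp : 0 ≤ p) : Continuous (posPow p) :=
  (continuous_id.max continuous_const).rpow_const fun _ => Or.inr hp

lemma hasDerivAt_posPow {p : ℝ} (hp : 1 < p) (v : ℝ) :
    HasDerivAt (posPow p) (p * posPow (p - 1) v) v := by
  have hr : ∀ v : ℝ, 0 ≤ v → HasDerivWithinAt (posPow p) (p * posPow (p - 1) v) (Set.Ici 0) v := by
    intro v hv
    rw [posPow_of_nonneg hv]
    exact ((Real.hasDerivAt_rpow_const (Or.inr hp.le)).hasDerivWithinAt).congr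
      (fun u hu => posPow_of_nonneg hu) (posPow_of_nonneg hv)
  have hl : ∀ v : ℝ, v ≤ 0 → HasDerivWithinAt (posPow p) (p * posPow (p - 1) v) (Set.Iic 0) v := by
    intro v hv
    rw [posPow_of_nonpos (by linarith) hv, mul_zero]
    exact (hasDerivWithinAt_const v _ (0 : ℝ)).congr
      (fun u hu => posPow_of_nonpos (by linarith) hu) (posPow_of_nonpos (by linarith) hv)
  rcases lt_trichotomy v 0 with h | rfl | h
  · exact (hl v h.le).hasDerivAt (Iic_mem_nhds h)
  · have := (hl 0 le_rfl).union (hr 0 le_rfl)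
    rwa [Set.Iic_union_Ici, hasDerivWithinAt_univ] at this
  · exact (hr v h.le).hasDerivAt (Ici_mem_nhds h)

lemma abs_posPow_sub_le {p : ℝ} (hp : 0 < p) (hp1 : p ≤ 1) (a b : ℝ) :
    |posPow p b - posPow p a| ≤ |b - a| ^ p := by
  have key : ∀ a b : ℝ, a ≤ b → |posPow p b - posPow p a| ≤ |b - a| ^ p := by
    intro a b hab
    have h0 := posPow_nonneg p a
    have hmono : posPow p a ≤ posPow p b :=
      Real.rpow_le_rpow (le_max_right _ _) (max_le_max_right 0 hab) hp.le
    rw [abs_of_nonneg (by linarith), abs_of_nonneg (by linarith), sub_le_iff_le_add']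
    refine (Real.rpow_le_rpow (le_max_right _ _) (?_ : max b 0 ≤ max a 0 + (b - a)) hp.le).trans
      (Real.rpow_add_le_add_rpow (le_max_right _ _) (by linarith) hp.le hp1)
    exact max_le (by linarith [le_max_left a 0]) (by linarith [le_max_right a 0])
  rcases le_total a b with h | h
  · exact key a b h
  · rw [abs_sub_comm, abs_sub_comm b a]; exact key b a h

/-- Taylor's formula for the power of the positive part, with a remainder of order `p`. -/
lemma exists_posPow_taylor_bound (m : ℕ) : ∀ p : ℝ, m < p → p ≤ m + 1 → ∃ K : ℝ, 0 < K ∧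
    ∀ a b : ℝ, |posPow p b - ∑ j ∈ Finset.range (m + 1), 1 / (j.factorial : ℝ) *
      ((∏ i ∈ Finset.range j, (p - i)) * posPow (p - j) a * (b - a) ^ j)| ≤ K * |b - a| ^ p := by
  induction m with
  | zero =>
    intro p h0 h1
    refine ⟨1, one_pos, fun a b => ?_⟩
    simpa using abs_posPow_sub_le (by simpa using h0) (by simpa using h1) a b
  | succ m ih =>
    intro p h0 h1
    push_cast at h0 h1
    obtain ⟨K, hK, hb⟩ := ih (p - 1) (by linarith) (by linarith)
    have hp : 0 < p := by linarith [Nat.cast_nonneg (α := ℝ) m]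
    refine ⟨p * K, by positivity, fun a b => ?_⟩
    set F : ℝ → ℝ := fun v => posPow p v - ∑ j ∈ Finset.range (m + 1 + 1), 1 / (j.factorial : ℝ) *
      ((∏ i ∈ Finset.range j, (p - i)) * posPow (p - j) a * (v - a) ^ j) with hF
    set F' : ℝ → ℝ := fun v => p * (posPow (p - 1) v - ∑ j ∈ Finset.range (m + 1),
      1 / (j.factorial : ℝ) *
        ((∏ i ∈ Finset.range j, (p - 1 - i)) * posPow (p - 1 - j) a * (v - a) ^ j)) with hF'
    have hFa : F a = 0 := by
      simp only [hF, Finset.sum_range_succ' _ (m + 1)]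
      simp
    have hder : ∀ v, HasDerivAt F (F' v) v := by
      intro v
      have e : F' v = p * posPow (p - 1) v - ∑ j ∈ Finset.range (m + 1 + 1), 1 / (j.factorial : ℝ) *
          ((∏ i ∈ Finset.range j, (p - i)) * posPow (p - j) a * (j * (v - a) ^ (j - 1))) := by
        simp only [hF', mul_sub, Finset.sum_range_succ' _ (m + 1)]
        simp only [CharP.cast_eq_zero, zero_mul, mul_zero, add_zero, Finset.mul_sum]
        congr 1
        refine Finset.sum_congr rfl fun j _ => ?_
        rw [Finset.prod_range_succ', Nat.factorial_succ]
        have hprod : ∏ i ∈ Finset.range j, (p - ((i + 1 : ℕ) : ℝ)) =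
            ∏ i ∈ Finset.range j, (p - 1 - i) :=
          Finset.prod_congr rfl fun i _ => by push_cast; ring
        have hpw : posPow (p - ((j + 1 : ℕ) : ℝ)) a = posPow (p - 1 - j) a := by
          congr 1; push_cast; ring
        rw [hprod, hpw]
        have : ((j : ℝ) + 1) ≠ 0 := by positivity
        have : (j.factorial : ℝ) ≠ 0 := by positivity
        push_cast
        field_simp
        ring
      rw [e]
      refine (hasDerivAt_posPow (by linarith [Nat.cast_nonneg (α := ℝ) m]) v).sub
        (HasDerivAt.fun_sum fun j _ => ?_)
      have := ((hasDerivAt_id v).sub_const a).pow j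
      have := (this.const_mul ((∏ i ∈ Finset.range j, (p - i)) * posPow (p - j) a)).const_mul
        (1 / (j.factorial : ℝ))
      simpa using this
    have hbound : ∀ v ∈ Set.uIcc a b, ‖F' v‖ ≤ p * K * |b - a| ^ (p - 1) := by
      intro v hv
      rw [Real.norm_eq_abs, hF', abs_mul, abs_of_pos hp, mul_assoc]
      refine mul_le_mul_of_nonneg_left ((hb a v).trans ?_) hp.le
      refine mul_le_mul_of_nonneg_left (Real.rpow_le_rpow (abs_nonneg _)
        (Set.abs_sub_left_of_mem_uIcc hv) ?_) hK.le
      linarith [Nat.cast_nonneg (α := ℝ) m]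
    have := Convex.norm_image_sub_le_of_norm_hasDerivWithin_le
      (fun v _ => (hder v).hasDerivWithinAt) hbound (convex_uIcc a b) Set.left_mem_uIcc
      Set.right_mem_uIcc
    rw [hFa, sub_zero, Real.norm_eq_abs, Real.norm_eq_abs, mul_assoc] at this
    rw [← Real.rpow_add_one' (abs_nonneg _) (by linarith), sub_add_cancel] at this
    exact this

lemma strictFloor_lt {β : ℝ} (hβ : 0 < β) : (strictFloor β : ℝ) < β := by
  have h1 : 0 < ⌈β⌉₊ := Nat.ceil_pos.2 hβ
  exact Nat.lt_ceil.1 (by unfold strictFloor; omega)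

lemma le_strictFloor_add_one {β : ℝ} (hβ : 0 < β) : β ≤ strictFloor β + 1 := by
  have h1 : 0 < ⌈β⌉₊ := Nat.ceil_pos.2 hβ
  have h2 : strictFloor β + 1 = ⌈β⌉₊ := by unfold strictFloor; omega
  have h3 := Nat.le_ceil β
  rw [← h2] at h3
  exact_mod_cast h3

lemma strictFloor_eq_zero {β : ℝ} (hβ1 : β ≤ 1) : strictFloor β = 0 := by
  have : ⌈β⌉₊ ≤ 1 := Nat.ceil_le.2 (by simpa using hβ1)
  unfold strictFloor; omega

lemma one_le_strictFloor {β : ℝ} (hβ : 1 < β) : 1 ≤ strictFloor β := by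
  have : 1 < ⌈β⌉₊ := Nat.lt_ceil.2 (by simpa using hβ)
  unfold strictFloor; omega

/-- For exponents at most `1` the Hölder condition is the usual one. -/
lemma isHolder_of_le_one {β L : ℝ} (hβ1 : β ≤ 1) {f : Ctx d → ℝ}
    (hf : ContinuousOn f (cube d))
    (h : ∀ x ∈ cube d, ∀ y ∈ cube d, |f y - f x| ≤ L * ‖x - y‖ ^ β) : IsHolder β L f := by
  rw [IsHolder, strictFloor_eq_zero hβ1]
  refine ⟨by simpa using hf, fun x hx y hy => ?_⟩
  simpa [taylorOnCube] using h x hx y hy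

lemma uniqueDiffOn_cube : UniqueDiffOn ℝ (cube d) := by
  have : cube d = Set.pi Set.univ fun _ => Set.Icc (0 : ℝ) 1 := by
    rw [cube, ← Set.pi_univ_Icc]; rfl
  rw [this]
  exact UniqueDiffOn.univ_pi fun _ => uniqueDiffOn_Icc one_pos

lemma IsHolder.congr {β L : ℝ} {f g : Ctx d → ℝ} (hf : IsHolder β L f)
    (h : Set.EqOn g f (cube d)) : IsHolder β L g := by
  refine ⟨hf.1.congr h, fun x hx y hy => ?_⟩
  have e : taylorOnCube (strictFloor β) g x y = taylorOnCube (strictFloor β) f x y := by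
    unfold taylorOnCube
    refine Finset.sum_congr rfl fun j _ => ?_
    rw [iteratedFDerivWithin_congr h hx]
  rw [e, h hy]
  exact hf.2 x hx y hy

lemma IsHolder.mono {β L L' : ℝ} {f : Ctx d → ℝ} (hf : IsHolder β L f) (h : L ≤ L') :
    IsHolder β L' f :=
  ⟨hf.1, fun x hx y hy => (hf.2 x hx y hy).trans (by gcongr)⟩

lemma iteratedDeriv_eq_of_hasDerivAt {m : ℕ} {D : ℕ → ℝ → ℝ}
    (hD : ∀ j < m, ∀ v, HasDerivAt (D j) (D (j + 1) v) v) :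
    ∀ j ≤ m, iteratedDeriv j (D 0) = D j := by
  intro j
  induction j with
  | zero => intro _; exact iteratedDeriv_zero
  | succ j ih =>
    intro hj
    rw [iteratedDeriv_succ, ih (by omega)]
    exact funext fun v => (hD j (by omega) v).deriv

lemma contDiff_of_hasDerivAt {m : ℕ} {D : ℕ → ℝ → ℝ}
    (hD : ∀ j < m, ∀ v, HasDerivAt (D j) (D (j + 1) v) v) (hc : Continuous (D m)) :
    ContDiff ℝ m (D 0) := by
  rw [contDiff_nat_iff_iteratedDeriv]
  have hdiff : ∀ j < m, Differentiable ℝ (D j) := fun j hj v => (hD j hj v).differentiableAt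
  refine ⟨fun j hj => ?_, fun j hj => ?_⟩
  · rw [iteratedDeriv_eq_of_hasDerivAt hD j hj]
    rcases hj.lt_or_eq with h | rfl
    · exact (hdiff j h).continuous
    · exact hc
  · rw [iteratedDeriv_eq_of_hasDerivAt hD j hj.le]
    exact hdiff j hj

/-- A sum of functions of single coordinates inherits the Hölder condition from the one-dimensional
Taylor remainder; here `D j` is the `j`-th derivative of the function `D 0`. -/
lemma isHolder_sum_coord {γ K : ℝ} (hγ : 0 ≤ γ) (hK : 0 ≤ K) (s : Finset (Fin d))
    {D : ℕ → ℝ → ℝ} (hD : ∀ j < strictFloor γ, ∀ v, HasDerivAt (D j) (D (j + 1) v) v)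
    (hc : Continuous (D (strictFloor γ)))
    (hT : ∀ a b : ℝ, |D 0 b - ∑ j ∈ Finset.range (strictFloor γ + 1),
      1 / (j.factorial : ℝ) * (D j a * (b - a) ^ j)| ≤ K * |b - a| ^ γ) :
    IsHolder γ (s.card * K) (fun x : Ctx d => ∑ i ∈ s, D 0 (x i)) := by
  have hcd := contDiff_of_hasDerivAt hD hc
  have hproj : ∀ i : Fin d, ContDiff ℝ (strictFloor γ) (fun x : Ctx d => D 0 (x i)) := fun i =>
    hcd.comp (contDiff_apply ℝ ℝ i)
  have hsum : ContDiff ℝ (strictFloor γ) (fun x : Ctx d => ∑ i ∈ s, D 0 (x i)) :=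
    ContDiff.sum fun i _ => hproj i
  refine ⟨hsum.contDiffOn, fun x hx y hy => ?_⟩
  have hcoord : ∀ j ≤ strictFloor γ, ∀ i : Fin d,
      iteratedFDeriv ℝ j (fun x : Ctx d => D 0 (x i)) x (fun _ => y - x) =
        D j (x i) * (y i - x i) ^ j := by
    intro j hj i
    have := (ContinuousLinearMap.proj (R := ℝ) (φ := fun _ : Fin d => ℝ) i).iteratedFDeriv_comp_right
      hcd x (i := j) (by exact_mod_cast hj)
    have e : (fun x : Ctx d => D 0 (x i)) =
      D 0 ∘ (ContinuousLinearMap.proj (R := ℝ) (φ := fun _ : Fin d => ℝ) i) := rfl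
    rw [e, this, ContinuousMultilinearMap.compContinuousLinearMap_apply,
      iteratedFDeriv_apply_eq_iteratedDeriv_mul_prod, iteratedDeriv_eq_of_hasDerivAt hD j hj]
    simp [mul_comm]
  have htay : taylorOnCube (strictFloor γ) (fun x : Ctx d => ∑ i ∈ s, D 0 (x i)) x y =
      ∑ i ∈ s, ∑ j ∈ Finset.range (strictFloor γ + 1),
        1 / (j.factorial : ℝ) * (D j (x i) * (y i - x i) ^ j) := by
    rw [Finset.sum_comm]
    unfold taylorOnCube
    refine Finset.sum_congr rfl fun j hj => ?_
    have hj' : j ≤ strictFloor γ := by simpa [Nat.lt_succ_iff] using hj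
    have hle : ((j : ℕ) : WithTop ℕ∞) ≤ ((strictFloor γ : ℕ) : WithTop ℕ∞) := by exact_mod_cast hj'
    rw [iteratedFDerivWithin_eq_iteratedFDeriv uniqueDiffOn_cube ((hsum.of_le hle).contDiffAt) hx,
      iteratedFDeriv_sum (fun i _ => (hproj i).of_le hle), ← Finset.mul_sum, Finset.sum_apply,
      sum_apply]
    congr 1
    exact Finset.sum_congr rfl fun i _ => hcoord j hj' i
  rw [htay, ← Finset.sum_sub_distrib]
  calc _ ≤ ∑ i ∈ s, K * ‖x - y‖ ^ γ := by
        refine (Finset.abs_sum_le_sum_abs _ _).trans (Finset.sum_le_sum fun i _ => ?_)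
        refine (hT (x i) (y i)).trans ?_
        have : |y i - x i| ≤ ‖x - y‖ := by
          rw [abs_sub_comm]; exact norm_le_pi_norm (x - y) i
        gcongr
    _ = _ := by rw [Finset.sum_const, nsmul_eq_mul]; ring

lemma isHolder_const {γ L : ℝ} (hγ : 0 < γ) (hL : 0 ≤ L) (hd : 1 ≤ d) (a : ℝ) :
    IsHolder γ L (fun _ : Ctx d => a) := by
  have h := isHolder_sum_coord (d := d) hγ.le le_rfl {⟨0, hd⟩} (K := 0)
    (D := fun j _ => if j = 0 then a else 0) (fun j _ v => by simpa using hasDerivAt_const v _)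
    continuous_const (fun u v => by
      rw [Finset.sum_range_succ']; simp)
  simp only [Finset.sum_singleton, if_true] at h
  exact h.mono (by simpa using hL)

lemma isHolder_affine {γ L : ℝ} (hγ : 1 < γ) (hL : 0 ≤ L) (a c : ℝ) (i : Fin d) :
    IsHolder γ L (fun x : Ctx d => a + c * x i) := by
  obtain ⟨m, hm⟩ : ∃ m, strictFloor γ = m + 1 := ⟨strictFloor γ - 1, by
    have := one_le_strictFloor hγ; omega⟩
  have h := isHolder_sum_coord (d := d) (γ := γ) (by linarith) le_rfl {i} (K := 0)
    (D := fun j v => if j = 0 then a + c * v else if j = 1 then c else 0) (fun j _ v => by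
      rcases j with _ | _ | j
      · simpa using ((hasDerivAt_id v).const_mul c).const_add a
      · simpa using hasDerivAt_const v c
      · simpa using hasDerivAt_const v (0 : ℝ)) (by
      rw [hm]
      rcases m with _ | m
      · simpa using continuous_const
      · simpa using continuous_const) (fun u v => by
      rw [hm, Finset.sum_range_succ', Finset.sum_range_succ']; simp; ring_nf)
  simp only [Finset.sum_singleton, if_true] at h
  exact h.mono (by simpa using hL)

lemma exists_isHolder_posPow {γ : ℝ} (hγ : 0 < γ) : ∃ K : ℝ, 0 < K ∧ ∀ (d : ℕ) (a c s : ℝ),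
    0 ≤ c → IsHolder γ (d * (c * K)) (fun x : Ctx d => ∑ i, (a - c * posPow γ (x i - s))) := by
  obtain ⟨K, hK, hb⟩ := exists_posPow_taylor_bound (strictFloor γ) γ (strictFloor_lt hγ)
    (le_strictFloor_add_one hγ)
  refine ⟨K, hK, fun d a c s hc => ?_⟩
  have h := isHolder_sum_coord (d := d) (γ := γ) hγ.le (mul_nonneg hc hK.le) Finset.univ
    (D := fun j v => (if j = 0 then a else 0) -
      c * ((∏ i ∈ Finset.range j, (γ - i)) * posPow (γ - j) (v - s))) ?_ ?_ ?_
  · simpa using h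
  · intro j hj v
    have h1 : 1 < γ - j := by
      have := strictFloor_lt hγ
      have h2 : (j : ℝ) + 1 ≤ strictFloor γ := by exact_mod_cast hj
      linarith
    have := (((hasDerivAt_posPow h1 (v - s)).comp_sub_const v s).const_mul
      (∏ i ∈ Finset.range j, (γ - i))).const_mul c
    have := this.const_sub (if j = 0 then a else 0)
    refine this.congr_deriv ?_
    rw [Finset.prod_range_succ, if_neg (Nat.succ_ne_zero j)]
    push_cast
    rw [sub_sub]
    ring
  · have := (continuous_posPow (sub_nonneg.2 (strictFloor_lt hγ).le)).comp
      (continuous_sub_right s)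
    exact continuous_const.sub (continuous_const.mul (continuous_const.mul this))
  · intro u v
    have h := hb (u - s) (v - s)
    have e : v - s - (u - s) = v - u := by ring
    rw [e] at h
    rw [mul_assoc]
    refine le_trans (le_of_eq ?_) (mul_le_mul_of_nonneg_left h hc)
    rw [← abs_of_nonneg hc, ← abs_mul, abs_of_nonneg hc, ← abs_neg]
    congr 1
    simp only [mul_sub, sub_mul, Finset.sum_sub_distrib, Finset.mul_sum]
    have e0 : ∑ j ∈ Finset.range (strictFloor γ + 1), 1 / (j.factorial : ℝ) *
        ((if j = 0 then a else 0) * (v - u) ^ j) = a := by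
      rw [Finset.sum_range_succ']; simp
    rw [e0]
    simp only [Finset.range_zero, Finset.prod_empty, CharP.cast_eq_zero, sub_zero, if_true, one_mul]
    have e1 : ∀ j ∈ Finset.range (strictFloor γ + 1), 1 / (j.factorial : ℝ) *
        (c * ((∏ i ∈ Finset.range j, (γ - i)) * posPow (γ - j) (u - s)) * (v - u) ^ j) =
        c * (1 / (j.factorial : ℝ) *
        ((∏ i ∈ Finset.range j, (γ - i)) * posPow (γ - j) (u - s) * (v - u) ^ j)) :=
      fun j _ => by ring
    rw [Finset.sum_congr rfl e1]
    ring

/-! ### Volumes in the cube and instances with a prescribed gap -/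

lemma measurableSet_cube : MeasurableSet (cube d) := measurableSet_Icc

lemma volume_cube : volume (cube d) = 1 := by
  simp [cube, Real.volume_Icc_pi]

instance : IsProbabilityMeasure ((volume : Measure (Ctx d)).restrict (cube d)) :=
  ⟨by rw [Measure.restrict_apply_univ, volume_cube]⟩

lemma mem_cube {x : Ctx d} : x ∈ cube d ↔ ∀ i, 0 ≤ x i ∧ x i ≤ 1 := by
  simp [cube, Set.mem_Icc, Pi.le_def, forall_and]

lemma norm_sub_le_one {x y : Ctx d} (hx : x ∈ cube d) (hy : y ∈ cube d) : ‖x - y‖ ≤ 1 := by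
  rw [pi_norm_le_iff_of_nonneg zero_le_one]
  intro i
  have a := mem_cube.1 hx i
  have b := mem_cube.1 hy i
  rw [Pi.sub_apply, Real.norm_eq_abs, abs_le]
  constructor <;> linarith

lemma volume_ne_top_of_subset_cube {s : Set (Ctx d)} (h : s ⊆ cube d) : volume s ≠ ⊤ :=
  ne_top_of_le_ne_top (by simp [volume_cube]) (measure_mono h)

lemma volume_slab_le (i : Fin d) {a b : ℝ} (hab : a ≤ b) :
    volume.real ({x : Ctx d | a ≤ x i ∧ x i ≤ b} ∩ cube d) ≤ b - a := by
  have hsub : {x : Ctx d | a ≤ x i ∧ x i ≤ b} ∩ cube d ⊆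
      Set.pi Set.univ fun k => if k = i then Set.Icc a b else Set.Icc (0 : ℝ) 1 := by
    rintro x ⟨hx, hc⟩ k -
    by_cases hk : k = i
    · subst hk; simpa using hx
    · simpa [hk] using mem_cube.1 hc k
  have hv : volume (Set.pi Set.univ fun k : Fin d => if k = i then Set.Icc a b
      else Set.Icc (0 : ℝ) 1) = ENNReal.ofReal (b - a) := by
    rw [volume_pi_pi, Finset.prod_eq_single i]
    · simp
    · intro k _ hk; simp [hk]
    · simp
  refine (measureReal_mono hsub (by rw [hv]; exact ENNReal.ofReal_ne_top)).trans ?_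
  rw [Measure.real, hv, ENNReal.toReal_ofReal (by linarith)]

lemma le_volume_slab (i : Fin d) {b : ℝ} (hb0 : 0 ≤ b) (hb1 : b ≤ 1) :
    b ≤ volume.real ({x : Ctx d | x i ≤ b} ∩ cube d) := by
  have hsub : (Set.pi Set.univ fun k => if k = i then Set.Icc 0 b else Set.Icc (0 : ℝ) 1) ⊆
      {x : Ctx d | x i ≤ b} ∩ cube d := by
    intro x hx
    have h : ∀ k, x k ∈ if k = i then Set.Icc 0 b else Set.Icc (0 : ℝ) 1 := fun k => hx k trivial
    have hi := h i
    simp only [if_true] at hi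
    refine ⟨hi.2, mem_cube.2 fun k => ?_⟩
    by_cases hk : k = i
    · subst hk; exact ⟨hi.1, hi.2.trans hb1⟩
    · have := h k; simpa [hk] using this
  have hv : volume (Set.pi Set.univ fun k : Fin d => if k = i then Set.Icc 0 b
      else Set.Icc (0 : ℝ) 1) = ENNReal.ofReal b := by
    rw [volume_pi_pi, Finset.prod_eq_single i]
    · simp
    · intro k _ hk; simp [hk]
    · simp
  refine le_trans ?_ (measureReal_mono hsub
    (volume_ne_top_of_subset_cube Set.inter_subset_right))
  rw [Measure.real, hv, ENNReal.toReal_ofReal hb0]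

lemma volume_corner_le {r : ℝ} (hr : 0 ≤ r) :
    volume.real ({x : Ctx d | ∀ i, x i ≤ r} ∩ cube d) ≤ r ^ d := by
  have hsub : {x : Ctx d | ∀ i, x i ≤ r} ∩ cube d ⊆
      Set.pi Set.univ fun _ => Set.Icc (0 : ℝ) r :=
    fun x hx k _ => ⟨(mem_cube.1 hx.2 k).1, hx.1 k⟩
  have hv : volume (Set.pi Set.univ fun _ : Fin d => Set.Icc (0 : ℝ) r) =
      ENNReal.ofReal (r ^ d) := by
    rw [volume_pi_pi]
    simp [ENNReal.ofReal_pow hr]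
  refine (measureReal_mono hsub (by rw [hv]; exact ENNReal.ofReal_ne_top)).trans ?_
  rw [Measure.real, hv, ENNReal.toReal_ofReal (by positivity)]

/-- A shell around a sphere of the sup norm is covered by `2 d` slabs. -/
lemma volume_shell_le (hd : 1 ≤ d) (c : Ctx d) (r : ℝ) {η : ℝ} (hη : 0 ≤ η) :
    volume.real ({x : Ctx d | |dist x c - r| ≤ η} ∩ cube d) ≤ 4 * d * η := by
  set A : Fin d → Set (Ctx d) := fun i =>
    ({x : Ctx d | c i + r - η ≤ x i ∧ x i ≤ c i + r + η} ∩ cube d) ∪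
      ({x : Ctx d | c i - r - η ≤ x i ∧ x i ≤ c i - r + η} ∩ cube d) with hA
  have hsub : {x : Ctx d | |dist x c - r| ≤ η} ∩ cube d ⊆ ⋃ i, A i := by
    rintro x ⟨hx, hc⟩
    have : Nonempty (Fin d) := ⟨⟨0, hd⟩⟩
    obtain ⟨i, hi⟩ := Finite.exists_max fun i => |x i - c i|
    have hdist : dist x c = |x i - c i| :=
      le_antisymm ((dist_pi_le_iff (abs_nonneg _)).2 fun k => hi k) (dist_le_pi_dist x c i)
    rw [Set.mem_ofPred_eq, hdist, abs_le] at hx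
    refine Set.mem_iUnion.2 ⟨i, ?_⟩
    rcases abs_cases (x i - c i) with ⟨h, -⟩ | ⟨h, -⟩
    · exact Or.inl ⟨⟨by linarith, by linarith⟩, hc⟩
    · exact Or.inr ⟨⟨by linarith, by linarith⟩, hc⟩
  have hAc : ∀ i, A i ⊆ cube d := fun i =>
    Set.union_subset Set.inter_subset_right Set.inter_subset_right
  have hAi : ∀ i, volume.real (A i) ≤ 4 * η := by
    intro i
    refine (measureReal_union_le _ _).trans ?_
    have h1 := volume_slab_le i (a := c i + r - η) (b := c i + r + η) (by linarith)
    have h2 := volume_slab_le i (a := c i - r - η) (b := c i - r + η) (by linarith)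
    linarith
  refine (measureReal_mono hsub (volume_ne_top_of_subset_cube (Set.iUnion_subset hAc))).trans ?_
  have := measureReal_iUnion_fintype_le (μ := (volume : Measure (Ctx d))) A
  refine this.trans ((Finset.sum_le_sum fun i _ => hAi i).trans (le_of_eq ?_))
  simp; ring

/-- The kernel of Bernoulli laws with mean `p` (for `p` with values in `[0, 1]`). -/
def bernoulliKernel {X : Type*} [MeasurableSpace X] (p : X → ℝ) (hp : Measurable p) :
    Kernel X Bool where
  toFun a := ENNReal.ofReal (p a) • Measure.dirac true +
    ENNReal.ofReal (1 - p a) • Measure.dirac false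
  measurable' := by
    refine Measure.measurable_of_measurable_coe _ fun s _ => ?_
    simp only [Measure.add_apply, Measure.smul_apply, smul_eq_mul]
    exact (hp.ennreal_ofReal.mul_const _).add ((measurable_const.sub hp).ennreal_ofReal.mul_const _)

/-- The payoffs of an instance whose first arm has payoff `1/2` and whose second arm has payoff
`1/2 - g`, truncated to `[1/4, 3/4]`. -/
def gapPayoff (g : Ctx d → ℝ) (kx : Fin 2 × Ctx d) : ℝ :=
  if kx.1 = 0 then 1 / 2 else max (1 / 4) (min (3 / 4) (1 / 2 - g kx.2))

lemma measurable_gapPayoff {g : Ctx d → ℝ} (hg : Measurable g) : Measurable (gapPayoff g) := by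
  refine Measurable.ite (measurable_fst (MeasurableSet.singleton 0)) measurable_const ?_
  exact measurable_const.max (measurable_const.min (measurable_const.sub (hg.comp measurable_snd)))

lemma gapPayoff_mem (g : Ctx d → ℝ) (kx : Fin 2 × Ctx d) :
    1 / 4 ≤ gapPayoff g kx ∧ gapPayoff g kx ≤ 3 / 4 := by
  unfold gapPayoff
  split_ifs
  · norm_num
  · exact ⟨le_max_left _ _, max_le (by norm_num) (min_le_left _ _)⟩

/-- The instance with uniform contexts in which the first arm has payoff `1/2` and the second arm
has payoff `1/2 - g` (truncated to `[1/4, 3/4]`). -/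
def gapInstance (g : Ctx d → ℝ) (hg : Measurable g) : Instance d where
  PX := volume.restrict (cube d)
  isProbabilityMeasure_PX := inferInstance
  PX_compl_cube := by
    rw [Measure.restrict_apply measurableSet_cube.compl]; simp
  reward := bernoulliKernel (gapPayoff g) (measurable_gapPayoff hg)
  isMarkovKernel_reward := ⟨fun kx => ⟨by
    have h := gapPayoff_mem g kx
    simp only [bernoulliKernel, Kernel.coe_mk, Measure.add_apply, Measure.smul_apply, smul_eq_mul,
      measure_univ, mul_one]
    rw [← ENNReal.ofReal_add (by linarith) (by linarith)]
    simp⟩⟩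

lemma gapInstance_payoff (g : Ctx d → ℝ) (hg : Measurable g) (k : Fin 2) (x : Ctx d) :
    (gapInstance g hg).payoff k x = gapPayoff g (k, x) := by
  have h := gapPayoff_mem g (k, x)
  simp [Instance.payoff, gapInstance, bernoulliKernel, Measure.real]
  linarith

lemma gapInstance_payoff_zero (g : Ctx d → ℝ) (hg : Measurable g) (x : Ctx d) :
    (gapInstance g hg).payoff 0 x = 1 / 2 := by
  simp [gapInstance_payoff, gapPayoff]

lemma gapInstance_payoff_one (g : Ctx d → ℝ) (hg : Measurable g) (x : Ctx d) :
    (gapInstance g hg).payoff 1 x = max (1 / 4) (min (3 / 4) (1 / 2 - g x)) := by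
  simp [gapInstance_payoff, gapPayoff]

lemma gapInstance_payoff_one_of_abs_le {g : Ctx d → ℝ} (hg : Measurable g) {x : Ctx d}
    (h : |g x| ≤ 1 / 4) : (gapInstance g hg).payoff 1 x = 1 / 2 - g x := by
  have := abs_le.1 h
  rw [gapInstance_payoff_one, min_eq_right (by linarith), max_eq_right (by linarith)]

lemma gapInstance_payoffsBounded (g : Ctx d → ℝ) (hg : Measurable g) :
    PayoffsBounded (gapInstance g hg) := fun k x => by
  rw [gapInstance_payoff]; exact gapPayoff_mem g (k, x)

lemma abs_gapInstance_payoff_sub_le {g g' : Ctx d → ℝ} (hg : Measurable g) (hg' : Measurable g')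
    (x : Ctx d) :
    |(gapInstance g hg).payoff 1 x - (gapInstance g' hg').payoff 1 x| ≤ |g x - g' x| := by
  rw [gapInstance_payoff_one, gapInstance_payoff_one]
  calc _ ≤ |min (3 / 4) (1 / 2 - g x) - min (3 / 4) (1 / 2 - g' x)| := by
        rw [max_comm (1 / 4 : ℝ), max_comm (1 / 4 : ℝ)]; exact abs_max_sub_max_le_abs _ _ _
    _ ≤ |(1 / 2 - g x) - (1 / 2 - g' x)| := by
        refine (abs_min_sub_min_le_max _ _ _ _).trans ?_
        simp
    _ = _ := by rw [abs_sub_comm]; congr 1; ring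

lemma gapInstance_PX_real (g : Ctx d → ℝ) (hg : Measurable g) (s : Set (Ctx d)) :
    (gapInstance g hg).PX.real s = volume.real (s ∩ cube d) := by
  simp only [gapInstance, Measure.real]
  rw [Measure.restrict_apply' measurableSet_cube]

lemma gapInstance_mem_problemClass (hd : 1 ≤ d) {β L α C₀ ρmin ρmax : ℝ} (hβ : 0 < β) (hL : 0 ≤ L)
    (hρ : ρmin ≤ 1) (hρ' : 1 ≤ ρmax) {g : Ctx d → ℝ} (hg : Measurable g)
    (hb : ∀ x ∈ cube d, |g x| ≤ 1 / 4) (hH : IsHolder β L (fun x => 1 / 2 - g x))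
    (hM : ∀ δ : ℝ, 0 < δ → δ ≤ 1 →
      volume.real ({x | 0 < |g x| ∧ |g x| ≤ δ} ∩ cube d) ≤ C₀ * δ ^ α) :
    gapInstance g hg ∈ problemClass d β L α C₀ ρmin ρmax := by
  refine ⟨fun k => ?_, ⟨fun _ => 1, measurable_const, fun _ _ => ⟨hρ, hρ'⟩, ?_⟩, fun δ h0 h1 => ?_⟩
  · have : k = 0 ∨ k = 1 := by omega
    rcases this with rfl | rfl
    · exact (isHolder_const hβ hL hd (1 / 2)).congr fun x _ => gapInstance_payoff_zero g hg x
    · exact hH.congr fun x hx => gapInstance_payoff_one_of_abs_le hg (hb x hx)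
  · simp [gapInstance]
  · rw [gapInstance_PX_real]
    refine le_trans (le_of_eq ?_) (hM δ h0 h1)
    congr 1
    ext x
    refine and_congr_left fun hx => ?_
    rw [Set.mem_ofPred_eq, Set.mem_ofPred_eq, gapInstance_payoff_zero,
      gapInstance_payoff_one_of_abs_le hg (hb x hx)]
    simp

/-! ### The flat gap and its bumps -/

lemma abs_posPow_sub_le_of_le_one {β γ : ℝ} (hβ : 0 < β) (hβ1 : β ≤ 1) (hβγ : β ≤ γ) {a b : ℝ}
    (ha : a ≤ 1) (hb : b ≤ 1) (hab : |b - a| ≤ 1) :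
    |posPow γ b - posPow γ a| ≤ max 1 γ * |b - a| ^ β := by
  have h0 : 0 ≤ |b - a| ^ β := Real.rpow_nonneg (abs_nonneg _) _
  rcases le_or_gt γ 1 with h | h
  · refine (abs_posPow_sub_le (hβ.trans_le hβγ) h a b).trans ?_
    refine (Real.rpow_le_rpow_of_exponent_ge' (abs_nonneg _) hab hβ.le hβγ).trans ?_
    exact le_mul_of_one_le_left h0 (le_max_left _ _)
  · have := Convex.norm_image_sub_le_of_norm_hasDerivWithin_le (C := γ)
      (fun v _ => (hasDerivAt_posPow h v).hasDerivWithinAt) (fun v (hv : v ∈ Set.Iic (1 : ℝ)) => by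
        rw [Real.norm_eq_abs, abs_mul, abs_of_pos (by linarith), abs_of_nonneg (posPow_nonneg _ _)]
        exact mul_le_of_le_one_right (by linarith) (posPow_le_one (by linarith) hv))
      (convex_Iic (1 : ℝ)) ha hb
    rw [Real.norm_eq_abs, Real.norm_eq_abs] at this
    refine this.trans ?_
    have h1 : |b - a| ≤ |b - a| ^ β := by
      have := Real.rpow_le_rpow_of_exponent_ge' (abs_nonneg (b - a)) hab hβ.le hβ1
      rwa [Real.rpow_one] at this
    gcongr
    exact le_max_right _ _

/-- The signed power `sign(v) |v| ^ β`. -/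
def signedPow (β v : ℝ) : ℝ := posPow β v - posPow β (-v)

lemma signedPow_of_nonneg {β v : ℝ} (hβ : 0 < β) (hv : 0 ≤ v) : signedPow β v = v ^ β := by
  rw [signedPow, posPow_of_nonneg hv, posPow_of_nonpos hβ.ne' (by linarith), sub_zero]

lemma signedPow_of_nonpos {β v : ℝ} (hβ : 0 < β) (hv : v ≤ 0) :
    signedPow β v = -(-v) ^ β := by
  rw [signedPow, posPow_of_nonpos hβ.ne' hv, posPow_of_nonneg (by linarith : 0 ≤ -v), zero_sub]

lemma abs_signedPow {β : ℝ} (hβ : 0 < β) (v : ℝ) : |signedPow β v| = |v| ^ β := by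
  rcases le_total 0 v with h | h
  · rw [signedPow_of_nonneg hβ h, abs_of_nonneg (Real.rpow_nonneg h _), abs_of_nonneg h]
  · rw [signedPow_of_nonpos hβ h, abs_neg, abs_of_nonneg (Real.rpow_nonneg (by linarith) _),
      abs_of_nonpos h]

lemma abs_signedPow_sub_le {β : ℝ} (hβ : 0 < β) (hβ1 : β ≤ 1) (a b : ℝ) :
    |signedPow β b - signedPow β a| ≤ 2 * |b - a| ^ β := by
  have h1 := abs_posPow_sub_le hβ hβ1 a b
  have h2 := abs_posPow_sub_le hβ hβ1 (-a) (-b)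
  have e : |-b - -a| = |b - a| := by rw [abs_sub_comm]; congr 1; ring
  rw [e] at h2
  have e2 : signedPow β b - signedPow β a =
    (posPow β b - posPow β a) - (posPow β (-b) - posPow β (-a)) := by unfold signedPow; ring
  rw [e2]
  exact (abs_sub _ _).trans (by linarith)

lemma continuous_signedPow {β : ℝ} (hβ : 0 ≤ β) : Continuous (signedPow β) :=
  (continuous_posPow hβ).sub ((continuous_posPow hβ).comp continuous_neg)

/-- A gap that equals `Δ` on the cube of side `s` and grows outside it like the power `γ` of the
distance. -/
def flatGap (γ c s Δ : ℝ) (x : Ctx d) : ℝ := Δ + c * ∑ i, posPow γ (x i - s)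

/-- The perturbation of a constant gap `K (h / 4) ^ β` in the ball of radius `h / 2` about `z`: the
perturbed gap is `K` times the signed power `β` of the signed distance to the sphere of radius
`h / 4`. -/
def bump (β K h : ℝ) (z x : Ctx d) : ℝ :=
  K * signedPow β (min (dist x z) (h / 2) - h / 4) - K * (h / 4) ^ β

lemma continuous_flatGap {γ : ℝ} (hγ : 0 ≤ γ) (c s Δ : ℝ) :
    Continuous (flatGap (d := d) γ c s Δ) := by
  refine continuous_const.add (continuous_const.mul (continuous_finsetSum _ fun i _ => ?_))
  exact (continuous_posPow hγ).comp ((continuous_apply i).sub continuous_const)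

lemma continuous_bump {β : ℝ} (hβ : 0 ≤ β) (K h : ℝ) (z : Ctx d) : Continuous (bump β K h z) := by
  refine (continuous_const.mul ((continuous_signedPow hβ).comp ?_)).sub continuous_const
  exact ((continuous_id.dist continuous_const).min continuous_const).sub continuous_const

lemma le_flatGap {γ c s Δ : ℝ} (hc : 0 ≤ c) (x : Ctx d) : Δ ≤ flatGap γ c s Δ x :=
  le_add_of_nonneg_right (mul_nonneg hc (Finset.sum_nonneg fun _ _ => posPow_nonneg _ _))

lemma flatGap_eq {γ c s Δ : ℝ} (hγ : 0 < γ) {x : Ctx d} (hx : ∀ i, x i ≤ s) :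
    flatGap γ c s Δ x = Δ := by
  rw [flatGap, Finset.sum_eq_zero, mul_zero, add_zero]
  exact fun i _ => posPow_of_nonpos hγ.ne' (by linarith [hx i])

lemma flatGap_le {γ c s Δ : ℝ} (hγ : 0 ≤ γ) (hc : 0 ≤ c) (hs : 0 ≤ s) {x : Ctx d}
    (hx : x ∈ cube d) : flatGap γ c s Δ x ≤ Δ + c * d := by
  refine add_le_add_right (mul_le_mul_of_nonneg_left ?_ hc) _
  refine (Finset.sum_le_sum (g := fun _ => (1 : ℝ)) fun i _ =>
    posPow_le_one hγ (by linarith [(mem_cube.1 hx i).2])).trans ?_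
  simp

lemma abs_flatGap_sub_le {β γ c s Δ : ℝ} (hβ : 0 < β) (hβ1 : β ≤ 1) (hβγ : β ≤ γ) (hc : 0 ≤ c)
    (hs : 0 ≤ s) {x y : Ctx d} (hx : x ∈ cube d) (hy : y ∈ cube d) :
    |flatGap γ c s Δ y - flatGap γ c s Δ x| ≤ c * d * max 1 γ * ‖x - y‖ ^ β := by
  have e : flatGap γ c s Δ y - flatGap γ c s Δ x =
      c * ∑ i, (posPow γ (y i - s) - posPow γ (x i - s)) := by
    rw [Finset.sum_sub_distrib]; unfold flatGap; ring
  rw [e, abs_mul, abs_of_nonneg hc, mul_assoc, mul_assoc]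
  refine mul_le_mul_of_nonneg_left ?_ hc
  calc _ ≤ ∑ _i : Fin d, max 1 γ * ‖x - y‖ ^ β := by
        refine (Finset.abs_sum_le_sum_abs _ _).trans (Finset.sum_le_sum fun i _ => ?_)
        have hxy : |y i - x i| ≤ ‖x - y‖ := by
          rw [abs_sub_comm]; exact norm_le_pi_norm (x - y) i
        have ee : y i - s - (x i - s) = y i - x i := by ring
        have h := abs_posPow_sub_le_of_le_one hβ hβ1 hβγ (a := x i - s) (b := y i - s)
          (by linarith [(mem_cube.1 hx i).2]) (by linarith [(mem_cube.1 hy i).2])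
          (by rw [ee]; exact hxy.trans (norm_sub_le_one hx hy))
        rw [ee] at h
        refine h.trans ?_
        have : (0 : ℝ) ≤ max 1 γ := zero_le_one.trans (le_max_left _ _)
        gcongr
    _ = _ := by simp

lemma abs_bump_sub_le {β K h : ℝ} (hβ : 0 < β) (hβ1 : β ≤ 1) (hK : 0 ≤ K) (z x y : Ctx d) :
    |bump β K h z y - bump β K h z x| ≤ 2 * K * ‖x - y‖ ^ β := by
  have e : bump β K h z y - bump β K h z x =
      K * (signedPow β (min (dist y z) (h / 2) - h / 4) -
        signedPow β (min (dist x z) (h / 2) - h / 4)) := by unfold bump; ring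
  rw [e, abs_mul, abs_of_nonneg hK]
  have h1 := abs_signedPow_sub_le hβ hβ1 (min (dist x z) (h / 2) - h / 4)
    (min (dist y z) (h / 2) - h / 4)
  have h2 : |min (dist y z) (h / 2) - h / 4 - (min (dist x z) (h / 2) - h / 4)| ≤ ‖x - y‖ := by
    have e3 : min (dist y z) (h / 2) - h / 4 - (min (dist x z) (h / 2) - h / 4) =
      min (dist y z) (h / 2) - min (dist x z) (h / 2) := by ring
    rw [e3]
    refine (abs_min_sub_min_le_max _ _ _ _).trans ?_
    rw [sub_self, abs_zero, max_eq_left (abs_nonneg _), ← dist_eq_norm, dist_comm x y]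
    exact abs_dist_sub_le y x z
  have h3 := Real.rpow_le_rpow (abs_nonneg _) h2 hβ.le
  calc _ ≤ K * (2 * ‖x - y‖ ^ β) := by gcongr; linarith
    _ = _ := by ring

lemma abs_signedPow_bump_le {β h : ℝ} (hβ : 0 < β) (hh : 0 ≤ h) (z x : Ctx d) :
    |signedPow β (min (dist x z) (h / 2) - h / 4)| ≤ (h / 4) ^ β := by
  rw [abs_signedPow hβ]
  refine Real.rpow_le_rpow (abs_nonneg _) (abs_le.2 ⟨?_, ?_⟩) hβ.le
  · have : 0 ≤ min (dist x z) (h / 2) := le_min dist_nonneg (by linarith)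
    linarith
  · linarith [min_le_right (dist x z) (h / 2)]

lemma abs_bump_le {β K h : ℝ} (hβ : 0 < β) (hK : 0 ≤ K) (hh : 0 ≤ h) (z x : Ctx d) :
    |bump β K h z x| ≤ 2 * (K * (h / 4) ^ β) := by
  have h1 := mul_le_mul_of_nonneg_left (abs_signedPow_bump_le hβ hh z x) hK
  have h2 : 0 ≤ K * (h / 4) ^ β := by positivity
  refine (abs_sub _ _).trans ?_
  rw [abs_mul, abs_of_nonneg hK, abs_of_nonneg h2]
  linarith

lemma bump_eq_zero {β K h : ℝ} (hβ : 0 < β) (hh : 0 ≤ h) {z x : Ctx d}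
    (hx : x ∉ Metric.ball z (h / 2)) : bump β K h z x = 0 := by
  have h1 : h / 2 ≤ dist x z := by simpa using hx
  have e : h / 2 - h / 4 = h / 4 := by ring
  rw [bump, min_eq_right h1, e, signedPow_of_nonneg hβ (by linarith), sub_self]

lemma bump_le {β K h : ℝ} (hβ : 0 < β) (hβ1 : β ≤ 1) (hK : 0 ≤ K) (hh : 0 ≤ h) {z x : Ctx d}
    (hx : x ∈ Metric.ball z (h / 8)) :
    bump β K h z x ≤ -(K * (h / 4) ^ β) - K * (h / 4) ^ β / 2 := by
  have h1 : dist x z < h / 8 := hx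
  rw [bump, min_eq_left (by linarith), signedPow_of_nonpos hβ (by linarith)]
  have h2 : (h / 8) ^ β ≤ (-(dist x z - h / 4)) ^ β :=
    Real.rpow_le_rpow (by linarith) (by linarith) hβ.le
  have h3 : (h / 4) ^ β / 2 ≤ (h / 8) ^ β := by
    have e : h / 8 = h / 4 * (1 / 2) := by ring
    rw [e, Real.mul_rpow (by linarith) (by norm_num)]
    have : (1 / 2 : ℝ) ≤ (1 / 2) ^ β := by
      have := Real.rpow_le_rpow_of_exponent_ge' (by norm_num : (0 : ℝ) ≤ 1 / 2) (by norm_num)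
        hβ.le hβ1
      simpa using this
    have h4 : 0 ≤ (h / 4) ^ β := by positivity
    nlinarith
  nlinarith

lemma isHolder_flatGap {γ : ℝ} (hγ : 0 < γ) : ∃ K : ℝ, 0 < K ∧ ∀ (d : ℕ) (c s Δ : ℝ), 1 ≤ d →
    0 ≤ c → IsHolder γ (d * (c * K)) (fun x : Ctx d => 1 / 2 - flatGap γ c s Δ x) := by
  obtain ⟨K, hK, h⟩ := exists_isHolder_posPow hγ
  refine ⟨K, hK, fun d c s Δ hd hc => (h d ((1 / 2 - Δ) / d) c s hc).congr fun x _ => ?_⟩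
  have : (d : ℝ) ≠ 0 := by positivity
  simp only [flatGap, Finset.sum_sub_distrib, ← Finset.mul_sum, Finset.sum_const, Finset.card_univ,
    Fintype.card_fin, nsmul_eq_mul]
  field_simp
  ring

/-- The margin condition for the flat gap: the side `s` of its flat part is tuned so that the flat
part has volume of order `Δ ^ α`. -/
lemma volume_flatGap_le (hd : 1 ≤ d) {α β γ K c h : ℝ} (hβ1 : β ≤ 1) (hα : 0 < α)
    (hγ : 0 < γ) (hαγ : α * γ ≤ d) (hK : 0 < K) (hc : 0 < c) (hh : 0 < h) {δ : ℝ}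
    (hδ : 0 < δ) (hδ1 : δ ≤ 1) :
    volume.real ({x : Ctx d |
      flatGap γ c (h ^ (α * β / d)) (K * (h / 4) ^ β) x ≤ δ} ∩ cube d) ≤
      ((4 / K) ^ (α / d) + (1 / c) ^ (1 / γ)) ^ d * δ ^ α := by
  have hd0 : (0 : ℝ) < d := by exact_mod_cast hd
  rcases lt_or_ge δ (K * (h / 4) ^ β) with hlt | hge
  · have : {x : Ctx d | flatGap γ c (h ^ (α * β / d)) (K * (h / 4) ^ β) x ≤ δ} ∩ cube d = ∅ := by
      ext x
      simp only [Set.mem_inter_iff, Set.mem_ofPred_eq, Set.mem_empty_iff_false, iff_false, not_and]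
      exact fun h' => absurd (h'.trans_lt hlt) (not_lt.2 (le_flatGap hc.le x))
    rw [this, measureReal_empty]
    positivity
  have hs : h ^ (α * β / d) ≤ (4 / K) ^ (α / d) * δ ^ (α / d) := by
    have e : h ^ (α * β / d) = (h ^ β) ^ (α / d) := by
      rw [← Real.rpow_mul hh.le]; congr 1; ring
    rw [e, ← Real.mul_rpow (by positivity) hδ.le]
    refine Real.rpow_le_rpow (by positivity) ?_ (by positivity)
    have h4 : (4 : ℝ) ^ β ≤ 4 := by
      have := Real.rpow_le_rpow_of_exponent_le (by norm_num : (1 : ℝ) ≤ 4) hβ1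
      simpa using this
    rw [Real.div_rpow hh.le (by norm_num)] at hge
    have hp : (0 : ℝ) < 4 ^ β := by positivity
    rw [← mul_div_assoc, div_le_iff₀ hp] at hge
    rw [div_mul_eq_mul_div, le_div_iff₀ hK]
    nlinarith
  have hr : (δ / c) ^ (1 / γ) ≤ (1 / c) ^ (1 / γ) * δ ^ (α / d) := by
    have e : δ / c = 1 / c * δ := by ring
    rw [e, Real.mul_rpow (by positivity) hδ.le]
    refine mul_le_mul_of_nonneg_left ?_ (by positivity)
    refine Real.rpow_le_rpow_of_exponent_ge hδ hδ1 ?_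
    rw [div_le_div_iff₀ hd0 hγ]
    linarith
  have hsub : {x : Ctx d | flatGap γ c (h ^ (α * β / d)) (K * (h / 4) ^ β) x ≤ δ} ∩ cube d ⊆
      {x : Ctx d | ∀ i, x i ≤ h ^ (α * β / d) + (δ / c) ^ (1 / γ)} ∩ cube d := by
    rintro x ⟨hx, hxc⟩
    refine ⟨fun i => ?_, hxc⟩
    have h1 : posPow γ (x i - h ^ (α * β / d)) ≤ δ / c := by
      rw [le_div_iff₀ hc]
      have h2 : posPow γ (x i - h ^ (α * β / d)) ≤ ∑ i, posPow γ (x i - h ^ (α * β / d)) :=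
        Finset.single_le_sum (f := fun i => posPow γ (x i - h ^ (α * β / d)))
          (fun _ _ => posPow_nonneg _ _) (Finset.mem_univ i)
      have h3 : flatGap γ c (h ^ (α * β / d)) (K * (h / 4) ^ β) x ≤ δ := hx
      have h4 : 0 ≤ K * (h / 4) ^ β := by positivity
      unfold flatGap at h3
      nlinarith
    have h5 := Real.rpow_le_rpow (posPow_nonneg _ _) h1 (by positivity : 0 ≤ 1 / γ)
    rw [posPow, ← Real.rpow_mul (le_max_right _ _), mul_one_div_cancel hγ.ne', Real.rpow_one] at h5
    linarith [le_max_left (x i - h ^ (α * β / d)) 0]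
  refine (measureReal_mono hsub (volume_ne_top_of_subset_cube Set.inter_subset_right)).trans ?_
  refine (volume_corner_le (by positivity)).trans ?_
  calc _ ≤ (((4 / K) ^ (α / d) + (1 / c) ^ (1 / γ)) * δ ^ (α / d)) ^ d := by
        refine pow_le_pow_left₀ (by positivity) ?_ d
        linarith
    _ = _ := by
        rw [mul_pow, ← Real.rpow_natCast (δ ^ (α / d)), ← Real.rpow_mul hδ.le,
          div_mul_cancel₀ _ hd0.ne']

/-- The margin condition near the zero set of a perturbed gap: the points where a signed power
`β` is at most `δ` have volume of order `δ ^ (1 / β) ≤ δ ^ α`, whatever the size `h` of the bump. -/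
lemma volume_crossing_le (hd : 1 ≤ d) {α β K h : ℝ} (hβ : 0 < β)
    (hαβ : α * β ≤ 1) (hK : 0 < K) (z : Ctx d) {δ : ℝ} (hδ : 0 < δ) (hδ1 : δ ≤ 1) :
    volume.real ({x : Ctx d | |K * signedPow β (dist x z - h / 4)| ≤ δ} ∩ cube d) ≤
      4 * d * (1 / K) ^ (1 / β) * δ ^ α := by
  have hsub : {x : Ctx d | |K * signedPow β (dist x z - h / 4)| ≤ δ} ∩ cube d ⊆
      {x : Ctx d | |dist x z - h / 4| ≤ (δ / K) ^ (1 / β)} ∩ cube d := by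
    rintro x ⟨hx, hxc⟩
    refine ⟨?_, hxc⟩
    rw [Set.mem_ofPred_eq, abs_mul, abs_of_pos hK, abs_signedPow hβ, ← le_div_iff₀' hK] at hx
    have := Real.rpow_le_rpow (by positivity) hx (by positivity : 0 ≤ 1 / β)
    rwa [← Real.rpow_mul (abs_nonneg _), mul_one_div_cancel hβ.ne', Real.rpow_one] at this
  refine (measureReal_mono hsub (volume_ne_top_of_subset_cube Set.inter_subset_right)).trans ?_
  refine (volume_shell_le hd z (h / 4) (by positivity)).trans ?_
  have e : δ / K = 1 / K * δ := by ring
  rw [e, Real.mul_rpow (by positivity) hδ.le, mul_assoc _ _ (δ ^ α)]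
  refine mul_le_mul_of_nonneg_left (mul_le_mul_of_nonneg_left ?_ (by positivity)) (by positivity)
  refine Real.rpow_le_rpow_of_exponent_ge hδ hδ1 ?_
  rw [le_div_iff₀ hβ]
  exact hαβ

/-! ### The lower bound from bumps on a flat gap -/

/-- The centres of the cells of side `h` of the cube of side `k h`. -/
def cellCenter {k : ℕ} (h : ℝ) (j : Fin d → Fin k) : Ctx d := fun i => h * ((j i : ℕ) + 1 / 2)

lemma mem_ball_cellCenter {k : ℕ} {h : ℝ} (hh : 0 < h) {j : Fin d → Fin k} {x : Ctx d}
    (hx : x ∈ Metric.ball (cellCenter h j) (h / 2)) (i : Fin d) :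
    h * (j i : ℕ) < x i ∧ x i < h * ((j i : ℕ) + 1) := by
  have h1 := (dist_pi_lt_iff (by linarith : 0 < h / 2)).1 hx i
  rw [Real.dist_eq, abs_lt, cellCenter] at h1
  constructor <;> linarith [h1.1, h1.2]

lemma pairwise_disjoint_cells {k : ℕ} {h : ℝ} (hh : 0 < h) :
    Pairwise fun j j' : Fin d → Fin k =>
      Disjoint (Metric.ball (cellCenter h j) (h / 2)) (Metric.ball (cellCenter h j') (h / 2)) := by
  intro j j' hne
  rw [Set.disjoint_left]
  intro x hx hx'
  refine hne (funext fun i => ?_)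
  have a := mem_ball_cellCenter hh hx i
  have b := mem_ball_cellCenter hh hx' i
  have h1 : ((j i : ℕ) : ℝ) < (j' i : ℕ) + 1 := lt_of_mul_lt_mul_left (a.1.trans b.2) hh.le
  have h2 : ((j' i : ℕ) : ℝ) < (j i : ℕ) + 1 := lt_of_mul_lt_mul_left (b.1.trans a.2) hh.le
  norm_cast at h1 h2
  omega

lemma mem_ball_cellCenter_le {k : ℕ} {h s : ℝ} (hh : 0 < h) (hks : h * k ≤ s) {j : Fin d → Fin k}
    {x : Ctx d} (hx : x ∈ Metric.ball (cellCenter h j) (h / 2)) (i : Fin d) :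
    0 ≤ x i ∧ x i ≤ s := by
  have a := mem_ball_cellCenter hh hx i
  have h1 : ((j i : ℕ) : ℝ) + 1 ≤ k := by exact_mod_cast (j i).2
  have h2 : 0 ≤ h * (j i : ℕ) := by positivity
  have h3 := mul_le_mul_of_nonneg_left h1 hh.le
  constructor <;> linarith

/-- The lower bound for a fixed bandwidth `h`: the alternatives are the bumps in the cells of side
`h` of the flat part, of side `h ^ (α β / d)`, of a `γ`-smooth gap. -/
theorem bump_lower_bound (hd : 1 ≤ d) {α β γ L ρmin ρmax K c h C₀ R : ℝ} (hβ : 0 < β)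
    (hβ1 : β ≤ 1) (hβγ : β < γ) (hα : 0 < α) (hαβ : α * β ≤ 1) (hαγ : α * γ ≤ d) (hL : 0 < L)
    (hρ : ρmin ≤ 1) (hρ' : 1 ≤ ρmax) (hK : 0 < K) (hK8 : K ≤ 1 / 8) (hKL : K ≤ L / 4)
    (hc : 0 < c) (hcd8 : c * d ≤ 1 / 8) (hcmax : c * d * max 1 γ ≤ L / 2)
    (hHol : ∀ s Δ : ℝ, IsHolder γ L (fun x : Ctx d => 1 / 2 - flatGap γ c s Δ x))
    (hC₀ : ((4 / K) ^ (α / d) + (1 / c) ^ (1 / γ)) ^ d + 4 * d * (1 / K) ^ (1 / β) ≤ C₀)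
    (hh : 0 < h) (hh1 : h ≤ 1) (hR0 : 0 ≤ R) (hhR : 384 * 2 ^ d * R * h ^ (β + d - α * β) ≤ 1)
    (T : ℕ) (π : Policy.{u} d)
    (hreg : worstRegret π (problemClass d γ L α C₀ ρmin ρmax) T ≤ (R : EReal)) :
    ((K * (h / 4) ^ β / 8 * (T * (h / 4) ^ d) : ℝ) : EReal) ≤
      worstRegret π (problemClass d β L α C₀ ρmin ρmax) T := by
  have hd0 : (0 : ℝ) < d := by exact_mod_cast hd
  have hd1 : (1 : ℝ) ≤ d := by exact_mod_cast hd
  have hγ : 0 < γ := hβ.trans hβγ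
  obtain ⟨A, hA⟩ : ∃ A, A = ((4 / K) ^ (α / d) + (1 / c) ^ (1 / γ)) ^ d := ⟨_, rfl⟩
  obtain ⟨A', hA'⟩ : ∃ A', A' = 4 * d * (1 / K) ^ (1 / β) := ⟨_, rfl⟩
  have hA0 : 0 < A := by rw [hA]; positivity
  have hA'0 : 0 < A' := by rw [hA']; positivity
  rw [← hA, ← hA'] at hC₀
  obtain ⟨s, hs⟩ : ∃ s, s = h ^ (α * β / d) := ⟨_, rfl⟩
  have hs0 : 0 < s := by rw [hs]; positivity
  have hs1 : s ≤ 1 := by rw [hs]; exact Real.rpow_le_one hh.le hh1 (by positivity)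
  have hhs : h ≤ s := by
    have h1 : α * β / d ≤ 1 := by rw [div_le_one hd0]; linarith
    have := Real.rpow_le_rpow_of_exponent_ge hh hh1 h1
    rwa [Real.rpow_one, ← hs] at this
  obtain ⟨Δ, hΔdef⟩ : ∃ Δ, Δ = K * (h / 4) ^ β := ⟨_, rfl⟩
  have hΔ : 0 < Δ := by rw [hΔdef]; positivity
  rw [← hΔdef]
  have hΔh : Δ ≤ h ^ β := by
    have h1 : (h / 4) ^ β ≤ h ^ β := Real.rpow_le_rpow (by positivity) (by linarith) hβ.le
    have h2 : 0 ≤ (h / 4) ^ β := by positivity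
    rw [hΔdef]
    nlinarith
  have hh4 : (h / 4) ^ β ≤ 1 := Real.rpow_le_one (by positivity) (by linarith) hβ.le
  have hΔK : Δ ≤ K := hΔdef ▸ mul_le_of_le_one_right hK.le hh4
  obtain ⟨k, hk⟩ : ∃ k : ℕ, k = ⌊s / h⌋₊ := ⟨_, rfl⟩
  have hsh : 1 ≤ s / h := by rw [one_le_div hh]; exact hhs
  have hk1 : 1 ≤ k := hk ▸ (Nat.one_le_floor_iff _).2 hsh
  have hks : h * k ≤ s := by
    have := Nat.floor_le (by positivity : 0 ≤ s / h)
    rw [← hk, le_div_iff₀ hh] at this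
    linarith
  have hks2 : s / (2 * h) ≤ k := by
    have h1 := Nat.lt_floor_add_one (s / h)
    have h2 : (1 : ℝ) ≤ k := by exact_mod_cast hk1
    have h3 : s / (2 * h) = s / h / 2 := by field_simp
    rw [← hk] at h1
    rw [h3]
    linarith
  set g₀ : Ctx d → ℝ := flatGap γ c s Δ with hg₀
  set g : (Fin d → Fin k) → Ctx d → ℝ := fun j x => g₀ x + bump β K h (cellCenter h j) x with hg
  have hg₀c : Continuous g₀ := continuous_flatGap hγ.le c s Δ
  have hgc : ∀ j, Continuous (g j) := fun j => hg₀c.add (continuous_bump hβ.le K h _)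
  have hg₀b : ∀ x ∈ cube d, |g₀ x| ≤ 1 / 4 := fun x hx => by
    have h1 := le_flatGap (γ := γ) (s := s) (Δ := Δ) hc.le x
    rw [abs_of_nonneg (hΔ.le.trans h1)]
    exact (flatGap_le hγ.le hc.le hs0.le hx).trans (by linarith)
  have hgb : ∀ j, ∀ x ∈ cube d, |g j x| ≤ 1 / 4 := fun j x hx => by
    have h1 := le_flatGap (γ := γ) (s := s) (Δ := Δ) hc.le x
    have h2 := flatGap_le (Δ := Δ) hγ.le hc.le hs0.le hx
    have h3 := abs_le.1 (abs_signedPow_bump_le hβ hh.le (cellCenter h j) x)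
    have h4 : g j x = g₀ x - Δ +
        K * signedPow β (min (dist x (cellCenter h j)) (h / 2) - h / 4) := by
      simp only [hg, bump, hΔdef]; ring
    rw [h4, abs_le]
    constructor <;> nlinarith
  have hHβ₀ : IsHolder β L (fun x => 1 / 2 - g₀ x) := by
    refine isHolder_of_le_one hβ1 (continuous_const.sub hg₀c).continuousOn fun x hx y hy => ?_
    have h1 := abs_flatGap_sub_le (Δ := Δ) hβ hβ1 hβγ.le hc.le hs0.le hx hy
    rw [sub_sub_sub_cancel_left, abs_sub_comm]
    refine h1.trans ?_
    gcongr
    linarith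
  have hHβ : ∀ j, IsHolder β L (fun x => 1 / 2 - g j x) := fun j => by
    refine isHolder_of_le_one hβ1 (continuous_const.sub (hgc j)).continuousOn fun x hx y hy => ?_
    have h1 := abs_flatGap_sub_le (Δ := Δ) hβ hβ1 hβγ.le hc.le hs0.le hx hy
    have h2 := abs_bump_sub_le (h := h) hβ hβ1 hK.le (cellCenter h j) x y
    rw [sub_sub_sub_cancel_left, abs_sub_comm]
    have h3 : g j y - g j x = (g₀ y - g₀ x) +
        (bump β K h (cellCenter h j) y - bump β K h (cellCenter h j) x) := by simp only [hg]; ring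
    rw [h3]
    refine (abs_add_le _ _).trans ?_
    have h4 : 0 ≤ ‖x - y‖ ^ β := by positivity
    calc _ ≤ L / 2 * ‖x - y‖ ^ β + 2 * (L / 4) * ‖x - y‖ ^ β := by
          refine add_le_add (h1.trans ?_) (h2.trans ?_) <;> gcongr
      _ = _ := by ring
  have hm₀ : ∀ δ : ℝ, 0 < δ → δ ≤ 1 → volume.real ({x | g₀ x ≤ δ} ∩ cube d) ≤ A * δ ^ α :=
    fun δ h0 h1 => by
    rw [hA, hg₀, hs, hΔdef]
    exact volume_flatGap_le hd hβ1 hα hγ hαγ hK hc hh h0 h1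
  have hM₀ : ∀ δ : ℝ, 0 < δ → δ ≤ 1 →
      volume.real ({x | 0 < |g₀ x| ∧ |g₀ x| ≤ δ} ∩ cube d) ≤ C₀ * δ ^ α := by
    intro δ h0 h1
    refine (measureReal_mono ?_ (volume_ne_top_of_subset_cube Set.inter_subset_right)).trans
      ((hm₀ δ h0 h1).trans ?_)
    · exact Set.inter_subset_inter_left _ fun x hx => (le_abs_self _).trans hx.2
    · gcongr
      linarith
  have hM : ∀ j, ∀ δ : ℝ, 0 < δ → δ ≤ 1 →
      volume.real ({x | 0 < |g j x| ∧ |g j x| ≤ δ} ∩ cube d) ≤ C₀ * δ ^ α := by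
    intro j δ h0 h1
    have hsub : {x | 0 < |g j x| ∧ |g j x| ≤ δ} ∩ cube d ⊆ ({x | g₀ x ≤ δ} ∩ cube d) ∪
        ({x | |K * signedPow β (dist x (cellCenter h j) - h / 4)| ≤ δ} ∩ cube d) := by
      rintro x ⟨hx, hxc⟩
      by_cases hxb : x ∈ Metric.ball (cellCenter h j) (h / 2)
      · refine Or.inr ⟨?_, hxc⟩
        have h2 : g₀ x = Δ := flatGap_eq hγ fun i => (mem_ball_cellCenter_le hh hks hxb i).2
        have h3 : dist x (cellCenter h j) ≤ h / 2 := (Metric.mem_ball.1 hxb).le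
        have h4 : g j x = K * signedPow β (dist x (cellCenter h j) - h / 4) := by
          simp only [hg, h2, bump, min_eq_left h3, hΔdef]; ring
        rw [Set.mem_ofPred_eq, ← h4]
        exact hx.2
      · refine Or.inl ⟨?_, hxc⟩
        have h2 : g j x = g₀ x := by simp only [hg, bump_eq_zero hβ hh.le hxb, add_zero]
        rw [Set.mem_ofPred_eq, ← h2]
        exact (le_abs_self _).trans hx.2
    refine (measureReal_mono hsub (volume_ne_top_of_subset_cube
      (Set.union_subset Set.inter_subset_right Set.inter_subset_right))).trans
      ((measureReal_union_le _ _).trans ?_)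
    have h2 := volume_crossing_le (h := h) hd hβ hαβ hK (cellCenter h j) h0 h1
    rw [← hA'] at h2
    have h3 := hm₀ δ h0 h1
    have h4 : (A + A') * δ ^ α ≤ C₀ * δ ^ α := by gcongr
    linarith
  have hball : ∀ j, Metric.ball (cellCenter h j : Ctx d) (h / 8) ⊆
      Metric.ball (cellCenter (k := k) h j) (h / 2) := fun j =>
    Metric.ball_subset_ball (by linarith)
  have hcube : ∀ j, Metric.ball (cellCenter (k := k) h j : Ctx d) (h / 2) ⊆ cube d := fun j x hx =>
    mem_cube.2 fun i => mem_ball_cellCenter_le hh (hks.trans hs1) hx i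
  have : Nonempty (Fin d → Fin k) := ⟨fun _ => ⟨0, hk1⟩⟩
  refine worstRegret_lower_bound (S' := problemClass d β L α C₀ ρmin ρmax) π
    (P := gapInstance g₀ hg₀c.measurable)
    (Q := fun j => gapInstance (g j) (hgc j).measurable) T
    (gapInstance_mem_problemClass hd hγ hL.le hρ hρ' hg₀c.measurable hg₀b
      (hHol s Δ) hM₀)
    (gapInstance_mem_problemClass hd hβ hL.le hρ hρ' hg₀c.measurable hg₀b hHβ₀ hM₀)
    (fun j => gapInstance_mem_problemClass hd hβ hL.le hρ hρ' (hgc j).measurable (hgb j) (hHβ j)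
      (hM j))
    (fun _ => rfl) (gapInstance_payoffsBounded _ _) (fun _ => gapInstance_payoffsBounded _ _)
    (fun _ _ => by rw [gapInstance_payoff_zero, gapInstance_payoff_zero])
    (B := fun j => Metric.ball (cellCenter h j) (h / 2))
    (B' := fun j => Metric.ball (cellCenter h j) (h / 8))
    (fun _ => measurableSet_ball) (pairwise_disjoint_cells hh) (fun _ => measurableSet_ball) hball
    (fun j x hx => by
      rw [gapInstance_payoff_one, gapInstance_payoff_one]
      simp only [hg, bump_eq_zero hβ hh.le hx, add_zero])
    hΔ
    (fun j x => (abs_gapInstance_payoff_sub_le _ _ x).trans (by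
      simp only [hg, sub_add_cancel_left, abs_neg]
      rw [hΔdef]
      exact abs_bump_le hβ hK.le hh.le _ _))
    (fun j x hx => by
      rw [gapInstance_payoff_zero, gapInstance_payoff_one_of_abs_le _ (hg₀b x (hcube j hx))]
      linarith [le_flatGap (γ := γ) (s := s) (Δ := Δ) hc.le x])
    (fun j x hx => by
      have hx' := hball j hx
      rw [gapInstance_payoff_zero, gapInstance_payoff_one_of_abs_le _ (hgb j x (hcube j hx'))]
      have h1 : g₀ x = Δ := flatGap_eq hγ fun i => (mem_ball_cellCenter_le hh hks hx' i).2
      have h2 := bump_le hβ hβ1 hK.le hh.le hx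
      rw [← hΔdef] at h2
      simp only [hg, h1]
      linarith)
    (m := (h / 4) ^ d) (fun j => by
      rw [gapInstance_PX_real, Set.inter_eq_left.2 ((hball j).trans (hcube j)), Measure.real,
        Real.volume_pi_ball _ (by positivity), ENNReal.toReal_ofReal (by positivity)]
      simp only [Fintype.card_fin]
      exact le_of_eq (by congr 1; ring))
    hreg ?_
  have h1 : (s / (2 * h)) ^ d ≤ (Fintype.card (Fin d → Fin k) : ℝ) := by
    rw [Fintype.card_fun, Fintype.card_fin, Fintype.card_fin]
    push_cast
    exact pow_le_pow_left₀ (by positivity) hks2 d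
  refine le_trans ?_ h1
  have h2 : s ^ d = h ^ (α * β) := by
    rw [hs, ← Real.rpow_natCast, ← Real.rpow_mul hh.le, div_mul_cancel₀ _ hd0.ne']
  have h3 : h ^ β * h ^ d = h ^ (α * β) * h ^ (β + d - α * β) := by
    rw [← Real.rpow_natCast h d, ← Real.rpow_add hh, ← Real.rpow_add hh]
    congr 1; ring
  rw [div_pow, le_div_iff₀ (by positivity), h2, mul_pow]
  calc 384 * Δ * R * (2 ^ d * h ^ d) ≤ 384 * h ^ β * R * (2 ^ d * h ^ d) := by gcongr
    _ = 384 * 2 ^ d * R * (h ^ β * h ^ d) := by ring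
    _ = 384 * 2 ^ d * R * h ^ (β + d - α * β) * h ^ (α * β) := by rw [h3]; ring
    _ ≤ h ^ (α * β) := mul_le_of_le_one_left (by positivity) hhR

/-- The lower bound from bumps on the flat part of a `γ`-smooth gap. -/
theorem flat_lower_bound (hd : 1 ≤ d) {α β γ L ρmin ρmax : ℝ} (hβ : 0 < β) (hβ1 : β ≤ 1)
    (hβγ : β < γ) (hα : 0 < α) (hαβ : α * β ≤ 1) (hαγ : α * γ ≤ d) (hL : 0 < L)
    (hρ : ρmin ≤ 1) (hρ' : 1 ≤ ρmax) :
    ∃ Cmin : ℝ, 0 < Cmin ∧ ∀ C₀ : ℝ, Cmin ≤ C₀ → ∃ c : ℝ, 0 < c ∧ ∀ R : ℝ, 1 ≤ R →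
      ∀ (T : ℕ) (π : Policy.{u} d),
      worstRegret π (problemClass d γ L α C₀ ρmin ρmax) T ≤ (R : EReal) →
      ((c * (T * R ^ (-((β + d) / (β + d - α * β)))) : ℝ) : EReal) ≤
        worstRegret π (problemClass d β L α C₀ ρmin ρmax) T := by
  have hd0 : (0 : ℝ) < d := by exact_mod_cast hd
  have hγ : 0 < γ := hβ.trans hβγ
  obtain ⟨Kγ, hKγ, hHol⟩ := isHolder_flatGap hγ
  have hmax : (0 : ℝ) < max 1 γ := lt_of_lt_of_le one_pos (le_max_left _ _)
  -- `c` and `K` are small enough for the Hölder constants and for payoffs in `[1/4, 3/4]`.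
  obtain ⟨K, hK, hK8, hKL⟩ : ∃ K : ℝ, 0 < K ∧ K ≤ 1 / 8 ∧ K ≤ L / 4 :=
    ⟨min (1 / 8) (L / 4), by positivity, min_le_left _ _, min_le_right _ _⟩
  obtain ⟨c₁, hc₁, hcd8, hcKγ, hcmax⟩ : ∃ c₁ : ℝ, 0 < c₁ ∧ c₁ ≤ 1 / 8 ∧ c₁ ≤ L / Kγ ∧
      c₁ ≤ L / (2 * max 1 γ) :=
    ⟨min (1 / 8) (min (L / Kγ) (L / (2 * max 1 γ))), by positivity, min_le_left _ _,
      (min_le_right _ _).trans (min_le_left _ _), (min_le_right _ _).trans (min_le_right _ _)⟩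
  obtain ⟨c, hcd⟩ : ∃ c : ℝ, c * d = c₁ := ⟨c₁ / d, div_mul_cancel₀ _ hd0.ne'⟩
  have hc : 0 < c := pos_of_mul_pos_left (hcd ▸ hc₁) hd0.le
  rw [← hcd] at hcd8 hcKγ hcmax
  rw [le_div_iff₀ hKγ] at hcKγ
  rw [le_div_iff₀ (by positivity)] at hcmax
  refine ⟨((4 / K) ^ (α / d) + (1 / c) ^ (1 / γ)) ^ d + 4 * d * (1 / K) ^ (1 / β), by positivity,
    fun C₀ hC₀ => ?_⟩
  obtain ⟨e, he⟩ : ∃ e, e = β + d - α * β := ⟨_, rfl⟩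
  have he0 : 0 < e := by
    have := mul_lt_mul_of_pos_left hβγ hα
    rw [he]; linarith
  obtain ⟨c₂, hc₂⟩ : ∃ c₂ : ℝ, c₂ = 1 / (384 * 2 ^ d) := ⟨_, rfl⟩
  have hc₂0 : 0 < c₂ := by rw [hc₂]; positivity
  refine ⟨K / 8 * (1 / 4) ^ (β + d) * c₂ ^ ((β + d) / e), by positivity, fun R hR T π hreg => ?_⟩
  have hR0 : 0 < R := by linarith
  -- The bandwidth `h` is the largest one for which a cell escapes exploration.
  obtain ⟨h, hhdef⟩ : ∃ h, h = (c₂ / R) ^ (1 / e) := ⟨_, rfl⟩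
  have hh : 0 < h := by rw [hhdef]; positivity
  have hcR : c₂ / R ≤ 1 := by
    rw [div_le_one hR0]
    refine le_trans ?_ hR
    rw [hc₂, div_le_one (by positivity)]
    have : (1 : ℝ) ≤ 2 ^ d := one_le_pow₀ (by norm_num)
    linarith
  have hh1 : h ≤ 1 := by
    rw [hhdef]; exact Real.rpow_le_one (by positivity) hcR (by positivity)
  have hhe : h ^ e = c₂ / R := by
    rw [hhdef, ← Real.rpow_mul (by positivity), one_div_mul_cancel he0.ne', Real.rpow_one]
  have key := bump_lower_bound hd hβ hβ1 hβγ hα hαβ hαγ hL hρ hρ' hK hK8 hKL hc hcd8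
    (by linarith) (fun s Δ => (hHol d c s Δ hd hc.le).mono (by linarith)) hC₀ hh hh1 hR0.le
    (by rw [← he, hhe, hc₂]; exact le_of_eq (by field_simp)) T π hreg
  refine le_trans (EReal.coe_le_coe_iff.2 (le_of_eq ?_)) key
  rw [← he]
  have h1 : h ^ (β + d) = c₂ ^ ((β + d) / e) * R ^ (-((β + d) / e)) := by
    rw [hhdef, ← Real.rpow_mul (by positivity), Real.rpow_neg hR0.le, ← div_eq_mul_inv,
      ← Real.div_rpow (by positivity) hR0.le]
    congr 1; ring
  have h2 : (h / 4) ^ β * (h / 4) ^ d = (1 / 4) ^ (β + d) * h ^ (β + d) := by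
    rw [← Real.rpow_natCast (h / 4) d, ← Real.rpow_add (by positivity),
      ← Real.mul_rpow (by positivity) hh.le]
    congr 1; ring
  calc _ = K * ((1 / 4) ^ (β + d) * (c₂ ^ ((β + d) / e) * R ^ (-((β + d) / e)))) / 8 * T := by
        ring
    _ = _ := by rw [← h1, ← h2]; ring

/-! ### The lower bound from a ridge on a linear gap -/

/-- The linear gap `K w / 2 + K x_i` (extended by a constant outside the cube). -/
def ridgeGap (K w : ℝ) (i : Fin d) (x : Ctx d) : ℝ := K * w / 2 + K * max (x i) 0

/-- The linear gap, lowered where `x_i < w` so that it changes sign at `x_i = w / 4`. -/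
def loweredRidgeGap (K w : ℝ) (i : Fin d) (x : Ctx d) : ℝ :=
  ridgeGap K w i x + K * (min (max (x i) 0) w - w)

lemma continuous_ridgeGap (K w : ℝ) (i : Fin d) : Continuous (ridgeGap K w i) := by
  unfold ridgeGap; fun_prop

lemma continuous_loweredRidgeGap (K w : ℝ) (i : Fin d) : Continuous (loweredRidgeGap K w i) :=
  (continuous_ridgeGap K w i).add (by fun_prop)

lemma abs_ridgeGap_sub_le {K : ℝ} (hK : 0 ≤ K) (w : ℝ) (i : Fin d) (x y : Ctx d) :
    |ridgeGap K w i y - ridgeGap K w i x| ≤ K * ‖x - y‖ := by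
  have e : ridgeGap K w i y - ridgeGap K w i x = K * (max (y i) 0 - max (x i) 0) := by
    unfold ridgeGap; ring
  rw [e, abs_mul, abs_of_nonneg hK]
  refine mul_le_mul_of_nonneg_left ((abs_max_sub_max_le_abs _ _ _).trans ?_) hK
  rw [abs_sub_comm]; exact norm_le_pi_norm (x - y) i

lemma abs_loweredRidgeGap_sub_le {K : ℝ} (hK : 0 ≤ K) (w : ℝ) (i : Fin d) (x y : Ctx d) :
    |loweredRidgeGap K w i y - loweredRidgeGap K w i x| ≤ 2 * K * ‖x - y‖ := by
  have e : loweredRidgeGap K w i y - loweredRidgeGap K w i x =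
      (ridgeGap K w i y - ridgeGap K w i x) +
        K * (min (max (y i) 0) w - min (max (x i) 0) w) := by
    unfold loweredRidgeGap; ring
  have h1 : |min (max (y i) 0) w - min (max (x i) 0) w| ≤ ‖x - y‖ := by
    refine (abs_min_sub_min_le_max _ _ _ _).trans ?_
    rw [sub_self, abs_zero, max_eq_left (abs_nonneg _)]
    refine (abs_max_sub_max_le_abs _ _ _).trans ?_
    rw [abs_sub_comm]; exact norm_le_pi_norm (x - y) i
  rw [e]
  refine (abs_add_le _ _).trans ?_
  rw [abs_mul, abs_of_nonneg hK]
  have h2 := mul_le_mul_of_nonneg_left h1 hK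
  linarith [abs_ridgeGap_sub_le hK w i x y]

lemma ridgeGap_bounds {K w : ℝ} (hK : 0 ≤ K) (hK16 : K ≤ 1 / 16) (hw1 : w ≤ 1)
    {i : Fin d} {x : Ctx d} (hx : x i ≤ 1) :
    K * w / 2 ≤ ridgeGap K w i x ∧ ridgeGap K w i x ≤ 1 / 4 := by
  have h1 : K * max (x i) 0 ≤ K := mul_le_of_le_one_right hK (max_le hx zero_le_one)
  have h2 : 0 ≤ K * max (x i) 0 := mul_nonneg hK (le_max_right _ _)
  have h3 : K * w ≤ K := mul_le_of_le_one_right hK hw1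
  unfold ridgeGap
  constructor <;> linarith

lemma volume_ridgeGap_le {α K w : ℝ} (hα1 : α ≤ 1) (hK : 0 < K) (hw : 0 ≤ w) (i : Fin d)
    {δ : ℝ} (hδ : 0 < δ) (hδ1 : δ ≤ 1) :
    volume.real ({x | ridgeGap K w i x ≤ δ} ∩ cube d) ≤ 1 / K * δ ^ α := by
  have hsub : {x | ridgeGap K w i x ≤ δ} ∩ cube d ⊆ {x | 0 ≤ x i ∧ x i ≤ δ / K} ∩ cube d := by
    rintro x ⟨hx, hxc⟩
    refine ⟨⟨(mem_cube.1 hxc i).1, ?_⟩, hxc⟩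
    have h1 : ridgeGap K w i x ≤ δ := hx
    rw [ridgeGap, max_eq_left (mem_cube.1 hxc i).1] at h1
    rw [le_div_iff₀ hK]
    have : 0 ≤ K * w := by positivity
    linarith
  refine (measureReal_mono hsub (volume_ne_top_of_subset_cube Set.inter_subset_right)).trans ?_
  refine (volume_slab_le i (by positivity)).trans ?_
  have h1 := Real.rpow_le_rpow_of_exponent_ge hδ hδ1 hα1
  rw [Real.rpow_one] at h1
  have h2 : 0 < 1 / K := by positivity
  calc _ = 1 / K * δ := by ring
    _ ≤ _ := by gcongr

lemma volume_loweredRidgeGap_le {α K w : ℝ} (hα1 : α ≤ 1) (hK : 0 < K) (hw : 0 ≤ w) (i : Fin d)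
    {δ : ℝ} (hδ : 0 < δ) (hδ1 : δ ≤ 1) :
    volume.real ({x | |loweredRidgeGap K w i x| ≤ δ} ∩ cube d) ≤ 2 / K * δ ^ α := by
  have hsub : {x | |loweredRidgeGap K w i x| ≤ δ} ∩ cube d ⊆
      ({x | ridgeGap K w i x ≤ δ} ∩ cube d) ∪
        ({x | w / 4 - δ / (2 * K) ≤ x i ∧ x i ≤ w / 4 + δ / (2 * K)} ∩ cube d) := by
    rintro x ⟨hx, hxc⟩
    have h0 := (mem_cube.1 hxc i).1
    have h1 : |loweredRidgeGap K w i x| ≤ δ := hx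
    rcases le_total w (x i) with h | h
    · refine Or.inl ⟨?_, hxc⟩
      rw [loweredRidgeGap, max_eq_left h0, min_eq_right h, sub_self, mul_zero, add_zero] at h1
      exact (le_abs_self _).trans h1
    · refine Or.inr ⟨?_, hxc⟩
      rw [loweredRidgeGap, ridgeGap, max_eq_left h0, min_eq_left h, abs_le] at h1
      have e : δ / (2 * K) * (2 * K) = δ := div_mul_cancel₀ _ (by positivity)
      constructor <;> by_contra! hlt
      · have := mul_lt_mul_of_pos_right hlt (by positivity : 0 < 2 * K)
        nlinarith [h1.1]
      · have := mul_lt_mul_of_pos_right hlt (by positivity : 0 < 2 * K)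
        nlinarith [h1.2]
  refine (measureReal_mono hsub (volume_ne_top_of_subset_cube
    (Set.union_subset Set.inter_subset_right Set.inter_subset_right))).trans
    ((measureReal_union_le _ _).trans ?_)
  have h1 := volume_ridgeGap_le hα1 hK hw i hδ hδ1
  have h2 : 0 < δ / (2 * K) := by positivity
  have h3 := volume_slab_le i (a := w / 4 - δ / (2 * K)) (b := w / 4 + δ / (2 * K)) (by linarith)
  have h4 := Real.rpow_le_rpow_of_exponent_ge hδ hδ1 hα1
  rw [Real.rpow_one] at h4
  have h5 : w / 4 + δ / (2 * K) - (w / 4 - δ / (2 * K)) = 1 / K * δ := by field_simp; ring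
  have h6 : 1 / K * δ ≤ 1 / K * δ ^ α := by gcongr
  have h7 : 2 / K * δ ^ α = 1 / K * δ ^ α + 1 / K * δ ^ α := by ring
  linarith

/-- The lower bound from a single ridge at the boundary, against a linear gap. -/
theorem ridge_lower_bound (hd : 1 ≤ d) {α γ L ρmin ρmax : ℝ} (hγ : 1 < γ) (hα1 : α ≤ 1)
    (hL : 0 < L) (hρ : ρmin ≤ 1) (hρ' : 1 ≤ ρmax) :
    ∃ Cmin : ℝ, 0 < Cmin ∧ ∀ C₀ : ℝ, Cmin ≤ C₀ → ∃ c : ℝ, 0 < c ∧ ∀ R : ℝ, 1 ≤ R →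
      ∀ (T : ℕ) (π : Policy.{u} d),
      worstRegret π (problemClass d γ L α C₀ ρmin ρmax) T ≤ (R : EReal) →
      ((c * (T * R ^ (-2 : ℝ)) : ℝ) : EReal) ≤
        worstRegret π (problemClass d 1 L α C₀ ρmin ρmax) T := by
  obtain ⟨K, hK, hK16, hKL⟩ : ∃ K : ℝ, 0 < K ∧ K ≤ 1 / 16 ∧ K ≤ L / 2 :=
    ⟨min (1 / 16) (L / 2), by positivity, min_le_left _ _, min_le_right _ _⟩
  refine ⟨2 / K, by positivity, fun C₀ hC₀ => ⟨K / 18432, by positivity, fun R hR T π hreg => ?_⟩⟩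
  have hR0 : 0 < R := by linarith
  obtain ⟨w, hw⟩ : ∃ w : ℝ, w = 1 / (12 * R) := ⟨_, rfl⟩
  have hw0 : 0 < w := by rw [hw]; positivity
  have hwR : w * R = 1 / 12 := by rw [hw]; field_simp
  have hw1 : w ≤ 1 := by nlinarith
  set i : Fin d := ⟨0, hd⟩
  have hc₀ := continuous_ridgeGap K w i
  have hc := continuous_loweredRidgeGap K w i
  have hb₀ : ∀ x ∈ cube d, |ridgeGap K w i x| ≤ 1 / 4 := fun x hx => by
    have h := ridgeGap_bounds hK.le hK16 hw1 (mem_cube.1 hx i).2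
    rw [abs_of_nonneg ((by positivity : 0 ≤ K * w / 2).trans h.1)]
    exact h.2
  have hdiff : ∀ x : Ctx d, -(K * w) ≤ K * (min (max (x i) 0) w - w) ∧
      K * (min (max (x i) 0) w - w) ≤ 0 := fun x => by
    have h1 : 0 ≤ min (max (x i) 0) w := le_min (le_max_right _ _) hw0.le
    have h2 := min_le_right (max (x i) 0) w
    constructor <;> nlinarith
  have hKw : K * w ≤ K := mul_le_of_le_one_right hK.le hw1
  have hb : ∀ x : Ctx d, x i ≤ 1 → |loweredRidgeGap K w i x| ≤ 1 / 4 := fun x hx => by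
    have h := ridgeGap_bounds hK.le hK16 hw1 hx
    have h1 := hdiff x
    rw [loweredRidgeGap, abs_le]
    constructor <;> linarith [h.1, h.2, h1.1, h1.2]
  have hH₀ : IsHolder 1 L (fun x => 1 / 2 - ridgeGap K w i x) :=
    isHolder_of_le_one le_rfl (continuous_const.sub hc₀).continuousOn fun x _ y _ => by
      rw [sub_sub_sub_cancel_left, abs_sub_comm, Real.rpow_one]
      refine (abs_ridgeGap_sub_le hK.le w i x y).trans ?_
      gcongr
      linarith
  have hHγ : IsHolder γ L (fun x => 1 / 2 - ridgeGap K w i x) :=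
    (isHolder_affine hγ hL.le (1 / 2 - K * w / 2) (-K) i).congr fun x hx => by
      simp only [ridgeGap, max_eq_left (mem_cube.1 hx i).1]; ring
  have hH : IsHolder 1 L (fun x => 1 / 2 - loweredRidgeGap K w i x) :=
    isHolder_of_le_one le_rfl (continuous_const.sub hc).continuousOn fun x _ y _ => by
      rw [sub_sub_sub_cancel_left, abs_sub_comm, Real.rpow_one]
      refine (abs_loweredRidgeGap_sub_le hK.le w i x y).trans ?_
      gcongr
      linarith
  have hM₀ : ∀ δ : ℝ, 0 < δ → δ ≤ 1 →
      volume.real ({x | 0 < |ridgeGap K w i x| ∧ |ridgeGap K w i x| ≤ δ} ∩ cube d) ≤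
        C₀ * δ ^ α := by
    intro δ h0 h1
    refine (measureReal_mono ?_ (volume_ne_top_of_subset_cube Set.inter_subset_right)).trans
      ((volume_ridgeGap_le hα1 hK hw0.le i h0 h1).trans ?_)
    · exact Set.inter_subset_inter_left _ fun x hx => (le_abs_self _).trans hx.2
    · have : 1 / K ≤ 2 / K := by gcongr; norm_num
      gcongr
      exact this.trans hC₀
  have hM : ∀ δ : ℝ, 0 < δ → δ ≤ 1 →
      volume.real ({x | 0 < |loweredRidgeGap K w i x| ∧ |loweredRidgeGap K w i x| ≤ δ} ∩ cube d) ≤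
        C₀ * δ ^ α := by
    intro δ h0 h1
    refine (measureReal_mono ?_ (volume_ne_top_of_subset_cube Set.inter_subset_right)).trans
      ((volume_loweredRidgeGap_le hα1 hK hw0.le i h0 h1).trans ?_)
    · exact Set.inter_subset_inter_left _ fun x hx => hx.2
    · gcongr
  have key := worstRegret_lower_bound (S' := problemClass d 1 L α C₀ ρmin ρmax) π (ι := Unit)
    (P := gapInstance (ridgeGap K w i) hc₀.measurable)
    (Q := fun _ => gapInstance (loweredRidgeGap K w i) hc.measurable) T
    (gapInstance_mem_problemClass hd (by linarith) hL.le hρ hρ' hc₀.measurable hb₀ hHγ hM₀)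
    (gapInstance_mem_problemClass hd one_pos hL.le hρ hρ' hc₀.measurable hb₀ hH₀ hM₀)
    (fun _ => gapInstance_mem_problemClass hd one_pos hL.le hρ hρ' hc.measurable
      (fun x hx => hb x (mem_cube.1 hx i).2) hH hM)
    (fun _ => rfl) (gapInstance_payoffsBounded _ _) (fun _ => gapInstance_payoffsBounded _ _)
    (fun _ _ => by rw [gapInstance_payoff_zero, gapInstance_payoff_zero])
    (B := fun _ => {x | x i < w}) (B' := fun _ => {x | x i ≤ w / 8})
    (fun _ => measurableSet_lt (measurable_pi_apply i) measurable_const)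
    (fun a b hab => absurd (Subsingleton.elim a b) hab)
    (fun _ => measurableSet_le (measurable_pi_apply i) measurable_const)
    (fun _ x (hx : x i ≤ w / 8) => show x i < w by linarith)
    (fun _ x hx => by
      have h1 : w ≤ x i := not_lt.1 hx
      rw [gapInstance_payoff_one, gapInstance_payoff_one, loweredRidgeGap,
        min_eq_right (h1.trans (le_max_left _ _)), sub_self, mul_zero, add_zero])
    (Δ := K * w / 2) (by positivity)
    (fun _ x => (abs_gapInstance_payoff_sub_le _ _ x).trans (by
      have h1 := hdiff x
      rw [loweredRidgeGap, sub_add_cancel_left, abs_neg, abs_le]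
      constructor <;> linarith))
    (fun _ x (hx : x i < w) => by
      have h := ridgeGap_bounds hK.le hK16 hw1 (i := i) (x := x) (by linarith)
      rw [gapInstance_payoff_zero, gapInstance_payoff_one_of_abs_le _
        (by rw [abs_of_nonneg ((by positivity : 0 ≤ K * w / 2).trans h.1)]; exact h.2)]
      linarith [h.1])
    (fun _ x (hx : x i ≤ w / 8) => by
      rw [gapInstance_payoff_zero, gapInstance_payoff_one_of_abs_le _ (hb x (by linarith))]
      have h1 : max (x i) 0 ≤ w / 8 := max_le hx (by linarith)
      rw [loweredRidgeGap, ridgeGap, min_eq_left (by linarith)]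
      nlinarith)
    (m := w / 8) (fun _ => by
      rw [gapInstance_PX_real]
      exact le_volume_slab i (by linarith) (by linarith))
    hreg (by
      simp only [Fintype.card_unit, Nat.cast_one]
      have : 384 * (K * w / 2) * R = 192 * K * (w * R) := by ring
      rw [this, hwR]
      linarith)
  refine le_trans (EReal.coe_le_coe_iff.2 (le_of_eq ?_)) key
  rw [Real.rpow_neg hR0.le, hw]
  norm_num
  field_simp
  ring

/-! ### Exponents, and the absence of adaptivity -/

lemma zeta_nonneg {γ α : ℝ} (hd : 1 ≤ d) (hγ : 0 < γ) (hα : α ≤ max 1 (1 / γ)) :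
    0 ≤ zeta γ α d := by
  have hd1 : (1 : ℝ) ≤ d := by exact_mod_cast hd
  have h : α * γ ≤ γ + 1 := by
    rcases le_max_iff.1 hα with h | h
    · nlinarith
    · rw [le_div_iff₀ hγ] at h; linarith
  rw [zeta, sub_nonneg, div_le_one (by positivity)]
  nlinarith

lemma zeta_mul_le {β γ α : ℝ} (hβ : 0 < β) (hβγ : β < γ) (hα : 0 < α) :
    zeta γ α d * (2 * β + d) ≤ β + d - α * β := by
  have hd0 : (0 : ℝ) ≤ d := Nat.cast_nonneg d
  have hβd : 0 < 2 * β + d := by positivity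
  have hγd : 0 < 2 * γ + d := by linarith
  have h : β * (1 + α) / (2 * β + d) ≤ γ * (1 + α) / (2 * γ + d) := by
    rw [div_le_div_iff₀ hβd hγd]
    nlinarith [mul_nonneg (mul_nonneg (sub_nonneg.2 hβγ.le) hd0) (by linarith : 0 ≤ 1 + α)]
  have h1 := mul_le_mul_of_nonneg_right h hβd.le
  rw [div_mul_cancel₀ _ hβd.ne'] at h1
  unfold zeta
  linarith

lemma lowerExponent_eq (β γ α : ℝ) (d : ℕ) : lowerExponent β γ α d =
    1 - (β + d) * (1 + α * zeta γ α d) / ((α + 1) * (2 * β + d - α * β)) := by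
  unfold lowerExponent; ring

lemma lowerExponent_le {β γ α : ℝ} (hβ : 0 < β) (hβγ : β < γ) (hα : 0 < α)
    (hαγ : α * γ ≤ d) :
    lowerExponent β γ α d ≤ 1 - (β + d) / (β + d - α * β) * zeta γ α d := by
  have hd0 : (0 : ℝ) ≤ d := Nat.cast_nonneg d
  have he : 0 < β + d - α * β := by nlinarith
  have hE : 0 < 2 * β + d - α * β := by linarith
  have h := zeta_mul_le (d := d) hβ hβγ hα
  rw [lowerExponent_eq, div_mul_eq_mul_div]
  refine sub_le_sub_left ?_ 1
  rw [div_le_div_iff₀ he (by positivity), mul_assoc, mul_assoc]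
  refine mul_le_mul_of_nonneg_left ?_ (by positivity)
  nlinarith

lemma lowerExponentOne_le_lowerExponent {γ α : ℝ} (hα : 0 < α) (hα1 : α ≤ 1)
    (hζ : 0 ≤ zeta γ α d) : lowerExponentOne γ α d ≤ lowerExponent 1 γ α d := by
  have hd0 : (0 : ℝ) ≤ d := Nat.cast_nonneg d
  have hE : 0 < 2 * 1 + (d : ℝ) - α * 1 := by linarith
  have e : lowerExponentOne γ α d = 1 - (1 + α * zeta γ α d) / (α + 1) := by
    unfold lowerExponentOne
    have : α + 1 ≠ 0 := by positivity
    field_simp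
    ring
  rw [lowerExponent_eq, e]
  refine sub_le_sub_left ?_ 1
  rw [div_le_div_iff₀ (by positivity) (by positivity)]
  have h1 : 0 ≤ (1 + α * zeta γ α d) * (α + 1) := by positivity
  nlinarith

lemma lowerExponentOne_le_of_lt {γ α : ℝ} (hγ : 0 < γ) (hα : 0 < α)
    (hαγ : (d : ℝ) < α * γ) : lowerExponentOne γ α d ≤ 1 - 2 * zeta γ α d := by
  have hd0 : (0 : ℝ) ≤ d := Nat.cast_nonneg d
  have h1 : α + 1 ≠ 0 := by positivity
  have h2 : 0 < 2 * γ + d := by positivity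
  have e1 : lowerExponentOne γ α d = α * γ / (2 * γ + d) := by
    unfold lowerExponentOne zeta
    field_simp
    ring
  have e2 : 1 - 2 * zeta γ α d = (2 * α * γ - d) / (2 * γ + d) := by
    unfold zeta
    field_simp
    ring
  rw [e1, e2]
  gcongr
  linarith

/-- The lower bound on the regret over the rough class in terms of a bound `R` on the regret over
the smooth class, with an exponent `b` that suffices for both claimed rates. -/
theorem exists_lower_bound {β γ α L ρmin ρmax : ℝ} (hd : 1 ≤ d) (hβ : 0 < β)
    (hβγ : β < γ) (hα : 0 < α) (hαγ : α ≤ max 1 (1 / γ)) (hL : 0 < L) (hρ : ρmin ≤ 1)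
    (hρ' : 1 ≤ ρmax) (hcase : γ ≤ 1 ∨ β = 1) :
    ∃ b : ℝ, 0 ≤ b ∧ (γ ≤ 1 → lowerExponent β γ α d ≤ 1 - b * zeta γ α d) ∧
      (β = 1 → lowerExponentOne γ α d ≤ 1 - b * zeta γ α d) ∧
      ∃ Cmin : ℝ, 0 < Cmin ∧ ∀ C₀ : ℝ, Cmin ≤ C₀ → ∃ c : ℝ, 0 < c ∧ ∀ R : ℝ, 1 ≤ R →
        ∀ (T : ℕ) (π : Policy.{u} d),
        worstRegret π (problemClass d γ L α C₀ ρmin ρmax) T ≤ (R : EReal) →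
        ((c * (T * R ^ (-b)) : ℝ) : EReal) ≤
          worstRegret π (problemClass d β L α C₀ ρmin ρmax) T := by
  have hd1 : (1 : ℝ) ≤ d := by exact_mod_cast hd
  have hγ : 0 < γ := hβ.trans hβγ
  have hζ := zeta_nonneg (d := d) hd hγ hαγ
  have hβ1 : β ≤ 1 := hcase.elim (fun h => hβγ.le.trans h) le_of_eq
  have hα1 : 1 < γ → α ≤ 1 := fun h =>
    hαγ.trans (max_le le_rfl ((div_le_one hγ).2 h.le))
  have hαγ1 : γ ≤ 1 → α * γ ≤ 1 := fun h => by
    rw [max_eq_right ((one_le_div hγ).2 h), le_div_iff₀ hγ] at hαγ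
    exact hαγ
  by_cases hflat : α * γ ≤ d
  · have hαβ : α * β ≤ 1 := by
      rcases hcase with h | h
      · exact (mul_le_mul_of_nonneg_left hβγ.le hα.le).trans (hαγ1 h)
      · rw [h, mul_one]; exact hα1 (h ▸ hβγ)
    have he : 0 < β + d - α * β := by nlinarith
    refine ⟨(β + d) / (β + d - α * β), by positivity,
      fun _ => lowerExponent_le hβ hβγ hα hflat, fun h => ?_,
      flat_lower_bound hd hβ hβ1 hβγ hα hαβ hflat hL hρ hρ'⟩
    subst h
    exact (lowerExponentOne_le_lowerExponent hα (hα1 hβγ) hζ).trans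
      (lowerExponent_le hβ hβγ hα hflat)
  · have hγ1 : 1 < γ := by
      by_contra! h
      exact hflat ((hαγ1 h).trans hd1)
    obtain rfl : β = 1 := hcase.resolve_left (not_le.2 hγ1)
    exact ⟨2, zero_le_two, fun h => absurd h (not_le.2 hγ1),
      fun _ => lowerExponentOne_le_of_lt hγ hα (not_le.1 hflat),
      ridge_lower_bound hd hγ1 (hα1 hγ1) hL hρ hρ'⟩

lemma eventually_log_rpow_le (C ι : ℝ) {ε η : ℝ} (hε : 0 < ε) (hη : 0 < η) :
    ∀ᶠ T : ℕ in atTop, C * Real.log T ^ ι ≤ η * (T : ℝ) ^ ε := by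
  have h := ((isLittleO_log_rpow_rpow_atTop ι hε).const_mul_left C).bound hη
  filter_upwards [tendsto_natCast_atTop_atTop.eventually h] with T hT
  rw [Real.norm_eq_abs, Real.norm_eq_abs, abs_of_nonneg (by positivity : 0 ≤ (T : ℝ) ^ ε)] at hT
  exact (le_abs_self _).trans hT

lemma le_one_div_min_one {α β γ : ℝ} (hβ : 0 < β) (hβγ : β ≤ γ) (hα : α ≤ max 1 (1 / γ)) :
    α ≤ 1 / min 1 β := by
  have h0 : 0 < min 1 β := lt_min one_pos hβ
  refine hα.trans (max_le ?_ ?_)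
  · rw [one_le_div h0]; exact min_le_left _ _
  · exact one_div_le_one_div_of_le h0 ((min_le_right _ _).trans hβγ)

/-- A polylogarithmic factor is absorbed by a small increase of the exponents, so a lower bound
whose exponent exceeds the one of the optimal rate excludes adaptivity. -/
theorem not_smoothnessAdaptive {β γ α L C₀ ρmin ρmax b c : ℝ} (hd : 1 ≤ d) (hβ : 0 < β)
    (hβγ : β < γ) (hα : 0 < α) (hαγ : α ≤ max 1 (1 / γ)) (hb : 0 ≤ b) (hc : 0 < c)
    (hlow : ∀ R : ℝ, 1 ≤ R → ∀ (T : ℕ) (π : Policy.{u} d),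
      worstRegret π (problemClass d γ L α C₀ ρmin ρmax) T ≤ (R : EReal) →
      ((c * (T * R ^ (-b)) : ℝ) : EReal) ≤ worstRegret π (problemClass d β L α C₀ ρmin ρmax) T)
    (hexp : zeta β α d < 1 - b * zeta γ α d) {βmin βmax : ℝ} (hmin : βmin ≤ β) (hmax : γ ≤ βmax) :
    ¬ ∃ π : ℕ → Policy.{u} d, SmoothnessAdaptive π βmin βmax L C₀ ρmin ρmax := by
  rintro ⟨π, hπ⟩
  obtain ⟨ι, -, C, -, h1⟩ := hπ γ α (hmin.trans hβγ.le) hmax hα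
    (le_one_div_min_one (hβ.trans hβγ) le_rfl hαγ)
  obtain ⟨ι', -, C', -, h2⟩ := hπ β α hmin (hβγ.le.trans hmax) hα
    (le_one_div_min_one hβ hβγ.le hαγ)
  obtain ⟨ε, hε⟩ : ∃ ε, ε = (1 - b * zeta γ α d - zeta β α d) / (b + 1) := ⟨_, rfl⟩
  have hε0 : 0 < ε := by rw [hε]; exact div_pos (by linarith) (by linarith)
  have hεb : ε * (b + 1) = 1 - b * zeta γ α d - zeta β α d := by
    rw [hε, div_mul_cancel₀ _ (by linarith)]
  obtain ⟨T, h1, h2, h3, h4, hT⟩ := (h1.and (h2.and ((eventually_log_rpow_le C ι hε0 one_pos).and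
    ((eventually_log_rpow_le C' ι' hε0 (half_pos hc)).and (eventually_ge_atTop 1))))).exists
  have hT1 : (1 : ℝ) ≤ T := by exact_mod_cast hT
  have hT0 : (0 : ℝ) < T := by linarith
  have hζ := zeta_nonneg (d := d) hd (hβ.trans hβγ) hαγ
  have hR : C * Real.log T ^ ι * (T : ℝ) ^ zeta γ α d ≤ (T : ℝ) ^ (ε + zeta γ α d) := by
    rw [Real.rpow_add hT0]
    gcongr
    linarith
  have h5 := hlow ((T : ℝ) ^ (ε + zeta γ α d)) (Real.one_le_rpow hT1 (by linarith)) T (π T)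
    (h1.trans (EReal.coe_le_coe_iff.2 hR))
  have h6 := EReal.coe_le_coe_iff.1 (h5.trans h2)
  have e : (T : ℝ) * ((T : ℝ) ^ (ε + zeta γ α d)) ^ (-b) = (T : ℝ) ^ ε * (T : ℝ) ^ zeta β α d := by
    rw [← Real.rpow_mul hT0.le, ← Real.rpow_one_add' hT0.le, ← Real.rpow_add hT0]
    · congr 1; linarith
    · have hx : 1 + (ε + zeta γ α d) * -b = ε + zeta β α d := by linarith
      have hζβ : 0 ≤ zeta β α d := zeta_nonneg hd hβ
        (hαγ.trans (max_le_max le_rfl (one_div_le_one_div_of_le hβ hβγ.le)))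
      rw [hx]; linarith
  rw [e] at h6
  have h7 : C' * Real.log T ^ ι' * (T : ℝ) ^ zeta β α d ≤
      c / 2 * (T : ℝ) ^ ε * (T : ℝ) ^ zeta β α d := by gcongr
  have h8 : 0 < c * ((T : ℝ) ^ ε * (T : ℝ) ^ zeta β α d) := by positivity
  nlinarith

lemma rate_le {T : ℝ} (hT : 1 ≤ T) {c K ζ b u v : ℝ} (hc : 0 < c) (hK : 0 < K)
    (h : u - ζ * v ≤ 1 - b * ζ) :
    c * K ^ (-b) * T ^ u * (T ^ ζ) ^ (-v) ≤ c * (T * (K * T ^ ζ) ^ (-b)) := by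
  have hT0 : 0 < T := by linarith
  rw [Real.mul_rpow hK.le (by positivity), ← Real.rpow_mul hT0.le, ← Real.rpow_mul hT0.le,
    mul_assoc, ← Real.rpow_add hT0]
  calc c * K ^ (-b) * T ^ (u + ζ * -v) ≤ c * K ^ (-b) * T ^ (1 + ζ * -b) := by
        have := Real.rpow_le_rpow_of_exponent_le hT (by linarith : u + ζ * -v ≤ 1 + ζ * -b)
        gcongr
    _ = _ := by rw [Real.rpow_add hT0, Real.rpow_one]; ring

end SmoothBandit

end

open SmoothBandit in
theorem theorem1 :
    (∀ (d : ℕ) (β γ α L ρmin ρmax : ℝ), 1 ≤ d → 0 < β → β < γ → 0 < α → α ≤ max 1 (1 / γ) →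
      0 < L → 0 < ρmin → ρmin ≤ 1 → 1 ≤ ρmax →
      ∃ Cmin : ℝ, 0 < Cmin ∧ ∀ C₀ : ℝ, Cmin ≤ C₀ →
        -- the lower bounds
        (∃ T₀ : ℕ, ∀ Cr : ℝ, 0 < Cr → ∃ C : ℝ, 0 < C ∧ ∀ T : ℕ, T₀ ≤ T → ∀ π : Policy.{u} d,
          worstRegret π (problemClass d γ L α C₀ ρmin ρmax) T ≤
              ((Cr * (T : ℝ) ^ zeta γ α d : ℝ) : EReal) →
          (γ ≤ 1 →
            ((C * (T : ℝ) ^ (1 - (β + d) / ((α + 1) * (2 * β + d - α * β))) *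
                ((T : ℝ) ^ zeta γ α d) ^ (-(α * (β + d) / ((α + 1) * (2 * β + d - α * β)))) : ℝ) :
                EReal) ≤
              worstRegret π (problemClass d β L α C₀ ρmin ρmax) T) ∧
          (β = 1 →
            ((C * (T : ℝ) ^ (α / (α + 1)) * ((T : ℝ) ^ zeta γ α d) ^ (-(α / (α + 1))) : ℝ) :
                EReal) ≤
              worstRegret π (problemClass d 1 L α C₀ ρmin ρmax) T)) ∧
        -- where they exceed the optimal rate, no policy is smoothness-adaptive
        ((γ ≤ 1 ∧ zeta β α d < lowerExponent β γ α d ∨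
            β = 1 ∧ zeta 1 α d < lowerExponentOne γ α d) →
          ∀ βmin βmax : ℝ, 0 < βmin → βmin ≤ β → γ ≤ βmax →
            ¬ ∃ π : ℕ → Policy.{u} d, SmoothnessAdaptive π βmin βmax L C₀ ρmin ρmax)) ∧
    -- such parameters exist, in both cases
    (∃ (d : ℕ) (β γ α : ℝ), 1 ≤ d ∧ 0 < β ∧ β < γ ∧ γ ≤ 1 ∧ 0 < α ∧ α ≤ max 1 (1 / γ) ∧
      zeta β α d < lowerExponent β γ α d) ∧
    (∀ γ : ℝ, 1 < γ → zeta 1 1 1 < lowerExponentOne γ 1 1) := by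
  refine ⟨fun d β γ α L ρmin ρmax hd hβ hβγ hα hαγ hL _ hρ hρ' => ?_, ?_, fun γ hγ => ?_⟩
  · by_cases hcase : γ ≤ 1 ∨ β = 1
    · obtain ⟨b, hb, hexp, hexp1, Cmin, hCmin, hlow⟩ :=
        exists_lower_bound hd hβ hβγ hα hαγ hL hρ hρ' hcase
      refine ⟨Cmin, hCmin, fun C₀ hC₀ => ?_⟩
      obtain ⟨c, hc, hlow⟩ := hlow C₀ hC₀
      refine ⟨⟨1, fun Cr hCr => ?_⟩, fun h βmin βmax _ hmin hmax => ?_⟩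
      · have hK : 0 < max Cr 1 := lt_max_of_lt_left hCr
        refine ⟨c * max Cr 1 ^ (-b), by positivity, fun T hT π hπ => ?_⟩
        have hT1 : (1 : ℝ) ≤ T := by exact_mod_cast hT
        have hR : 1 ≤ max Cr 1 * (T : ℝ) ^ zeta γ α d :=
          one_le_mul_of_one_le_of_one_le (le_max_right _ _)
            (Real.one_le_rpow hT1 (zeta_nonneg hd (hβ.trans hβγ) hαγ))
        have key := hlow _ hR T π (hπ.trans (EReal.coe_le_coe_iff.2
          (mul_le_mul_of_nonneg_right (le_max_left _ _) (by positivity))))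
        exact ⟨fun h => (EReal.coe_le_coe_iff.2 (rate_le hT1 hc hK (hexp h))).trans key,
          fun h => (EReal.coe_le_coe_iff.2 (rate_le hT1 hc hK (hexp1 h))).trans (h ▸ key)⟩
      · refine not_smoothnessAdaptive hd hβ hβγ hα hαγ hb hc hlow ?_ hmin hmax
        rcases h with ⟨h, h'⟩ | ⟨h, h'⟩
        · exact h'.trans_le (hexp h)
        · rw [h]; exact h'.trans_le (hexp1 h)
    · rw [not_or] at hcase
      exact ⟨1, one_pos, fun C₀ _ => ⟨⟨0, fun Cr _ => ⟨1, one_pos, fun T _ π _ =>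
        ⟨fun h => absurd h hcase.1, fun h => absurd h hcase.2⟩⟩⟩,
        fun h => (h.elim (fun h => hcase.1 h.1) (fun h => hcase.2 h.1)).elim⟩⟩
  · refine ⟨1, 1 / 20, 1 / 10, 10, ?_⟩
    norm_num [zeta, lowerExponent]
  · have h : 0 < 2 * γ + 1 := by linarith
    have e : lowerExponentOne γ 1 1 = γ / (2 * γ + 1) := by
      unfold lowerExponentOne zeta
      push_cast
      field_simp
      ring
    rw [e, lt_div_iff₀ h]
    norm_num [zeta]
    linarith
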